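/- **Information systems.** An *information system with witnesses* is $(A,\mathrm{Con},\vdash,\Delta)$ with $A$ a set of tokens, $\Delta\in A$, $\mathrm{Con}\subseteq A\times\mathcal P_f(A)$ and ${\vdash}\subseteq \mathrm{Con}\times A$, where $X\in\mathrm{Con}(i)$ means $(i,X)\in\mathrm{Con}$ and, for $(i,X)\in\mathrm{Con}$, $(i,X)\vdash Y$ means $(i,X)\vdash a$ for all $a\in Y$, such that for all $i,j,a\in A$ and finite $X,Y\subseteq A$: (1) $\{i\}\in\mathrm{Con}(i)$; (2) $Y\subseteq X\in\mathrm{Con}(i)\Rightarrow Y\in\mathrm{Con}(i)$; (3) $(i,\emptyset)\vdash\Delta$; (4) $X\in\mathrm{Con}(i)\wedge(i,X)\vdash Y\Rightarrow Y\in\mathrm{Con}(i)$; (5) $X,Y\in\mathrm{Con}(i)\wedge X\subseteq Y\wedge(i,X)\vdash a\Rightarrow(i,Y)\vdash a$; (6) $X\in\mathrm{Con}(i)\wedge(i,X)\vdash Y\wedge(i,Y)\vdash a\Rightarrow(i,X)\vdash a$; (7) $(i,X)\vdash a\Rightarrow\exists Z\in\mathrm{Con}(i)\,[(i,X)\vdash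 Z\wedge(i,Z)\vdash a]$; (8) $X\in\mathrm{Con}(i)\wedge(i,X)\vdash Y\Rightarrow\exists e\in A\,[(i,X)\vdash e\wedge Y\in\mathrm{Con}(e)]$; (9) $\{i\}\in\mathrm{Con}(j)\Rightarrow\mathrm{Con}(i)\subseteq\mathrm{Con}(j)$; (10) if $\{i\}\in\mathrm{Con}(j)$ and $X\in\mathrm{Con}(i)$, then $(i,X)\vdash a\Leftrightarrow(j,X)\vdash a$. **The category.** An *approximable mapping* $H:A\Rightarrow A'$ is a relation $H\subseteq\mathrm{Con}\times A'$ such that, for $(i,X)\in\mathrm{Con}$, $j\in A$, finite $X'\subseteq A$, $b\in A'$, $(k,Y)\in\mathrm{Con}'$ and finite $F\subseteq A'$ (with $(i,X)HF$ meaning $(i,X)Hc$ for all $c\in F$, and $(i,X)H(k,Y)$ meaning $(i,X)Hk$ and $(i,X)HY$): (i) $(\Delta,\emptyset)H\Delta'$; (ii) $X\subseteq X'\in\mathrm{Con}(i)\wedge(i,X)Hb\Rightarrow(i,X')Hb$; (iii) $(i,X)\vdash X'\wedge(i,X')Hb\Rightarrow(i,X)Hb$; (iv) $(i,X)Hb\Rightarrow\exists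 U\in\mathrm{Con}(i)\,[(i,X)\vdash U\wedge(i,U)Hb]$; (v) $(i,X)H(k,Y)\wedge(k,Y)\vdash'b\Rightarrow(i,X)Hb$; (vi) $(i,X)Hb\Rightarrow\exists(d,V)\in\mathrm{Con}'\,[(i,X)H(d,V)\wedge(d,V)\vdash'b]$; (vii) $(i,X)HF\Rightarrow\exists e\in A'\,[(i,X)He\wedge F\in\mathrm{Con}'(e)]$; (viii) if $\{i\}\in\mathrm{Con}(j)$, then $(i,X)Hb\Leftrightarrow(j,X)Hb$. $\mathbf{ISW}$ is the category of information systems with witnesses and approximable mappings, with identities $\mathrm{Id}_A={\vdash}$ and composition (first $H$, then $G$) $(i,X)(H\circ G)c\Leftrightarrow\exists(j,Y)\in\mathrm{Con}'\,[(i,X)H(j,Y)\wedge(j,Y)Gc]$. The categorical product of $A_1$ and $A_2$ is $A_1\times A_2$ with $\Delta_\times=(\Delta_1,\Delta_2)$, where $X\in\mathrm{Con}_\times(i_1,i_2)$ iff $\mathrm{pr}_\nu(X)\in\mathrm{Con}_\nu(i_\nu)$ for $\nu=1,2$, and $((i_1,i_2),X)\vdash_\times(a_1,a_2)$ iff $(i_\nu,\mathrm{pr}_\nu(X))\vdash_\nu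 a_\nu$ for $\nu=1,2$; and $((a,b),U)(F\times G)(c,d)$ iff $(a,\mathrm{pr}_1U)Fc$ and $(b,\mathrm{pr}_2U)Gd$. **Function space.** For finite $X\subseteq A$ write $i\sim j\,[X]$ if there are $n\ge1$ and $a_0=i,a_1,\dots,a_n=j$, $k_1,\dots,k_n$ in $A$ with $X\in\mathrm{Con}(a_{\nu-1})\cap\mathrm{Con}(a_\nu)$ and $\{a_{\nu-1}\},\{a_\nu\}\in\mathrm{Con}(k_\nu)$ for $1\le\nu\le n$. For finite $\mathfrak X\subseteq\mathrm{Con}$ put $\bigcup\mathrm{pr}_2(\mathfrak X)=\bigcup\{X\mid(i,X)\in\mathfrak X\}$, $$W(\mathfrak X)=\{a\in A\mid \textstyle\bigcup\mathrm{pr}_2(\mathfrak X)\in\mathrm{Con}(a)\wedge\forall(i,X)\in\mathfrak X\;\,a\sim i\,[X]\},$$ $$\mathrm{Cl}((a,S),\mathfrak X)=\{(i,X)\in\mathfrak X\mid\exists j\in A\;[\,i\sim j\,[X]\wedge(a,S)\vdash j\wedge(a,S)\vdash X\,]\}.$$ Let $\mathfrak V\subseteq\mathrm{Con}\times A'$ be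 finite and, for $J\subseteq\mathfrak V$, put $X_J=\bigcup\mathrm{pr}_2(\mathrm{pr}_1(J))$. For $a\in A$ and $J\subseteq\mathfrak V$, $(a,J)$ is *$\mathfrak V$-maximal* if $a\in W(\mathrm{pr}_1(J))$ and every $((i,X),c)\in\mathfrak V$ with $X\subseteq X_J$ and $a\sim i\,[X]$ lies in $J$. A set $\mathfrak W\subseteq\mathrm{Con}\times A'$ is an *associate* of $\mathfrak V$ if there are systems $R(\mathrm{pr}_1(J))$ of representatives of $W(\mathrm{pr}_1(J))$ with respect to $\sim[X_J]$, for all $J\subseteq\mathfrak V$, with $R(\emptyset)=\{\Delta\}$ and $R(\{(i,X)\})=\{i\}$ for $(i,X)\in\mathrm{pr}_1(\mathfrak V)$, and an increasing chain $(\mathfrak W^{(\kappa)})_{\kappa\ge0}$ with union $\mathfrak W$, such that $\mathfrak W^{(0)}$ is $\{((\Delta,\emptyset),\Delta')\}$ if $(\Delta,\emptyset)$ is $\mathfrak V$-maximal and $\emptyset$ otherwise, and, for $\kappa\ge1$, $\mathfrak W^{(\kappa)}=\mathfrak W^{(\kappa-1)}\cup\widehat{\mathfrak W}^{(\kappa)}$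 where (a) for all $J\subseteq\mathfrak V$ with $|J|=\kappa$ and all $e\in R(\mathrm{pr}_1(J))$ with $(e,J)$ $\mathfrak V$-maximal there is exactly one $j\in A'$ with $T_{e,J}\in\mathrm{Con}'(j)$ and $((e,X_J),j)\in\widehat{\mathfrak W}^{(\kappa)}$, where $T_{e,J}$ is the set of all $t\in A'$ for which there are $a\in A$ and $K\subseteq\mathfrak V$ with $X_K\subseteq X_J$, $a\sim e\,[X_K]$ and either $|K|=1$ and $((a,X_K),t)\in\mathfrak V$, or $a\in R(\mathrm{pr}_1(K))$ and $((a,X_K),t)\in\mathfrak W^{(\kappa-1)}$; (b) each element of $\widehat{\mathfrak W}^{(\kappa)}$ is $((e,X_J),j)$ for some $J\subseteq\mathfrak V$ with $|J|=\kappa$, $e\in R(\mathrm{pr}_1(J))$, $(e,J)$ $\mathfrak V$-maximal, and $T_{e,J}\in\mathrm{Con}'(j)$. For $(a,S)\in\mathrm{Con}$ let $\mathrm{sp}((a,S),\mathfrak V)=\{((i,X),c)\in\mathfrak V\mid a\sim i\,[X]\wedge X\subseteq S\}$, $\mathrm{ds}=\mathrm{pr}_1(\mathrm{sp})$, $\mathrm{rs}=\mathrm{pr}_2(\mathrm{sp})$,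 and $\mathrm{ap}((a,S),\mathfrak V)=\{c\mid((i,X),c)\in\mathfrak V\text{ for some }(i,X)\in\mathrm{Cl}((a,S),\mathrm{pr}_1(\mathfrak V))\}$. If $\mathfrak W$ is an associate of $\mathfrak V$ and $T=\bigcup\mathrm{pr}_2(\mathrm{Cl}((a,S),\mathrm{pr}_1(\mathfrak V)))$, then $\mathfrak W_2(a,S)$ denotes the second component of the (unique) pair $(e,j)$ with $e\in W(\mathrm{Cl}((a,S),\mathrm{pr}_1(\mathfrak V)))$, $a\sim e\,[T]$, $\mathrm{ap}((a,S),\mathfrak V)\in\mathrm{Con}'(j)$ and $((e,T),j)\in\mathfrak W$. The tokens of $A\to A'$ are the pairs $\langle\mathfrak W|\mathfrak V\rangle$ with $\mathfrak V\subseteq\mathrm{Con}\times A'$ finite and $\mathfrak W$ an associate of $\mathfrak V$; $\Delta_\to=\langle\{((\Delta,\emptyset),\Delta')\}|\emptyset\rangle$. For a finite set $F$ of tokens let $\bigcup F$ be the union of the second components of its elements. Then $F\in\mathrm{Con}_\to(\langle\mathfrak W|\mathfrak V\rangle)$ iff for all $(a,S)\in\mathrm{Con}$: for each $\langle\mathfrak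 G|\mathfrak F\rangle\in F$ there is $k\in A'$ with $\mathfrak G_2(a,S)\sim k\,[\mathrm{ap}((a,S),\mathfrak F)]$ and $\{k\}\in\mathrm{Con}'(\mathfrak W_2(a,S))$; and for all $r\in A'$, $r\sim\mathfrak W_2(a,S)\,[\mathrm{ap}((a,S),\mathfrak V)]$ implies $r\sim\mathfrak W_2(a,S)\,[\mathrm{ap}((a,S),\bigcup F)]$. For such $F$, $(\langle\mathfrak W|\mathfrak V\rangle,F)\vdash_\to\langle\mathfrak B|\mathfrak A\rangle$ iff $(\mathfrak W_2(e,Y),\mathrm{ap}((e,Y),\bigcup F))\vdash'f$ for all $((e,Y),f)\in\mathfrak A$, and for all $((a,Z),b)\in\mathfrak B$ there is $k\in A'$ with $b\sim k\,[\mathrm{rs}((a,Z),\mathfrak A)]$ and $$\Bigl(\mathfrak W_2(a,Z),\ \bigcup\{\mathrm{ap}((e,Y),\textstyle\bigcup F)\mid(e,Y)\in\mathrm{ds}((a,Z),\mathfrak A)\}\Bigr)\vdash'\{k\}\cup\mathrm{rs}((a,Z),\mathfrak A).$$ **Evaluation and currying.** For $(\langle\mathfrak B|\mathfrak A\rangle,a)\in(A\to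 A')\times A$, $\mathbb Z\in\mathrm{Con}_{(A\to A')\times A}(\langle\mathfrak B|\mathfrak A\rangle,a)$ and $b\in A'$, $$((\langle\mathfrak B|\mathfrak A\rangle,a),\mathbb Z)\;\mathrm{Ev}\;b\iff\bigl(\mathfrak B_2(a,\mathrm{pr}_2\mathbb Z),\ \mathrm{ap}((a,\mathrm{pr}_2\mathbb Z),\textstyle\bigcup\mathrm{pr}_1\mathbb Z)\bigr)\vdash'b.$$ For an information system with witnesses $C$, an approximable mapping $H:C\times A\Rightarrow A'$, $(c,S)\in\mathrm{Con}_C$ and a token $\langle\mathfrak B|\mathfrak A\rangle$ of $A\to A'$, let $(c,S)\,\Lambda(H)\,\langle\mathfrak B|\mathfrak A\rangle$ iff $((c,i),S\otimes X)He$ for all $((i,X),e)\in\mathfrak A$, and for all $((d,T),b)\in\mathfrak B$ there is $j\in A'$ with $((c,d),S\otimes T)Hj$ and $j\sim b\,[\mathrm{rs}((d,T),\mathfrak A)]$. Here $S\otimes X=S^+\times X^+$, where $Y^+=Y$ if $Y\neq\emptyset$, and $\emptyset^+$ is $\{\Delta\}$ with $\Delta$ the distinguished token of the respective system. **Proposition.**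 Let $A$ and $A'$ be information systems with witnesses. Then $(A\to A',\mathrm{Con}_\to,\vdash_\to,\Delta_\to)$ is an information system with witnesses, $\mathrm{Ev}:(A\to A')\times A\Rightarrow A'$ is an approximable mapping, and $(A\to A',\mathrm{Ev})$ is the exponent of $A$ and $A'$ in $\mathbf{ISW}$: for every information system with witnesses $C$ and every $H:C\times A\Rightarrow A'$ there is exactly one $G:C\Rightarrow(A\to A')$ with $(G\times\mathrm{Id}_A)\circ\mathrm{Ev}=H$. Moreover, for all such $C$: for every $H:C\times A\Rightarrow A'$, $\Lambda(H):C\Rightarrow(A\to A')$ is an approximable mapping with $(\Lambda(H)\times\mathrm{Id}_A)\circ\mathrm{Ev}=H$; and for every $G:C\Rightarrow(A\to A')$, $\Lambda((G\times\mathrm{Id}_A)\circ\mathrm{Ev})=G$. -/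

import Mathlib

open CategoryTheory

universe u

/-- Raw data of an information system with witnesses: a set of tokens, a consistency relation
`Con i X` (written `X ∈ Con(i)` on paper), an entailment relation `Ent i X a`
(on paper `(i, X) ⊢ a`) and a distinguished token `bot` (on paper `Δ`). -/
structure WitSystem where
  carrier : Type u
  Con : carrier → Finset carrier → Prop
  Ent : carrier → Finset carrier → carrier → Prop
  bot : carrier

namespace WitSystem

instance : CoeSort WitSystem.{u} (Type u) := ⟨WitSystem.carrier⟩

instance (A : WitSystem.{u}) : Nonempty A.carrier := ⟨A.bot⟩

/-- `(i, X) ⊢ Y` for a finite set `Y` of tokens. -/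
def EntSet (A : WitSystem.{u}) (i : A) (X Y : Finset A) : Prop := ∀ a ∈ Y, A.Ent i X a

/-- The axioms of an information system with witnesses. The first field says that the entailment
relation is a subset of `Con × A`. -/
structure IsISW (A : WitSystem.{u}) : Prop where
  ent_con : ∀ {i X a}, A.Ent i X a → A.Con i X
  con_self : ∀ i, A.Con i {i}
  con_subset : ∀ {i X Y}, Y ⊆ X → A.Con i X → A.Con i Y
  ent_bot : ∀ i, A.Ent i ∅ A.bot
  con_of_ent : ∀ {i X Y}, A.Con i X → A.EntSet i X Y → A.Con i Y
  ent_mono : ∀ {i X Y a}, A.Con i X → A.Con i Y → X ⊆ Y → A.Ent i X a → A.Ent i Y a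
  ent_trans : ∀ {i X Y a}, A.Con i X → A.EntSet i X Y → A.Ent i Y a → A.Ent i X a
  ent_interp : ∀ {i X a}, A.Ent i X a → ∃ Z, A.Con i Z ∧ A.EntSet i X Z ∧ A.Ent i Z a
  ent_witness : ∀ {i X Y}, A.Con i X → A.EntSet i X Y → ∃ e, A.Ent i X e ∧ A.Con e Y
  con_wit : ∀ {i j X}, A.Con j {i} → A.Con i X → A.Con j X
  ent_wit : ∀ {i j X a}, A.Con j {i} → A.Con i X → A.Ent i X a → A.Ent j X a
  ent_cons : ∀ {i j X a}, A.Con j {i} → A.Con i X → A.Ent j X a → A.Ent i X a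

/-- `H`, a relation between `Con` and `A'`, is an approximable mapping from `A` to `A'`. -/
structure IsApprox (A A' : WitSystem.{u}) (H : A → Finset A → A' → Prop) : Prop where
  dom : ∀ {i X b}, H i X b → A.Con i X
  bot : H A.bot ∅ A'.bot
  mono : ∀ {i X X' b}, A.Con i X → A.Con i X' → X ⊆ X' → H i X b → H i X' b
  ent_left : ∀ {i X X' b}, A.Con i X → A.EntSet i X X' → H i X' b → H i X b
  interp_left : ∀ {i X b}, H i X b → ∃ U, A.Con i U ∧ A.EntSet i X U ∧ H i U b
  ent_right : ∀ {i X k Y b}, A.Con i X → A'.Con k Y → H i X k → (∀ c ∈ Y, H i X c) →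
    A'.Ent k Y b → H i X b
  interp_right : ∀ {i X b}, H i X b →
    ∃ d V, A'.Con d V ∧ H i X d ∧ (∀ c ∈ V, H i X c) ∧ A'.Ent d V b
  witness : ∀ {i X} {F : Finset A'}, A.Con i X → (∀ c ∈ F, H i X c) → ∃ e, H i X e ∧ A'.Con e F
  wit : ∀ {i j X b}, A.Con i X → A.Con j {i} → H i X b → H j X b
  cons : ∀ {i j X b}, A.Con i X → A.Con j {i} → H j X b → H i X b

end WitSystem

/-- Information systems with witnesses. -/
structure ISW extends WitSystem.{u} where
  isISW : toWitSystem.IsISW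

namespace ISW

open WitSystem

instance : CoeSort ISW.{u} (Type u) := ⟨fun A => A.carrier⟩

theorem con_empty (A : ISW.{u}) (i : A) : A.Con i ∅ :=
  A.isISW.con_subset (Finset.empty_subset _) (A.isISW.con_self i)

theorem con_bot (A : ISW.{u}) (i : A) : A.Con i {A.bot} :=
  A.isISW.con_of_ent (A.con_empty i) (by
    intro a ha; rw [Finset.mem_singleton] at ha; subst ha; exact A.isISW.ent_bot i)

theorem con_of_ent_single (A : ISW.{u}) {i j : A} {X : Finset A} (h : A.Ent i X j) :
    A.Con i {j} :=
  A.isISW.con_of_ent (A.isISW.ent_con h) (by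
    intro a ha; rw [Finset.mem_singleton] at ha; subst ha; exact h)

theorem ent_bot' (A : ISW.{u}) {i : A} {X : Finset A} (h : A.Con i X) : A.Ent i X A.bot :=
  A.isISW.ent_mono (A.con_empty i) h (Finset.empty_subset _) (A.isISW.ent_bot i)

theorem ent_strong (A : ISW.{u}) {i j : A} {X Y : Finset A} {a : A}
    (h1 : A.Ent i X j) (h2 : A.EntSet i X Y) (h3 : A.Ent j Y a) : A.Ent i X a :=
  A.isISW.ent_trans (A.isISW.ent_con h1) h2
    (A.isISW.ent_wit (A.con_of_ent_single h1) (A.isISW.ent_con h3) h3)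

end ISW

namespace WitSystem.IsApprox

open WitSystem

variable {A B : ISW.{u}} {H : A → Finset A → B → Prop}

theorem strong (h : IsApprox A.toWitSystem B.toWitSystem H) {i j : A} {X Y : Finset A} {b : B}
    (h1 : A.Ent i X j) (h2 : A.EntSet i X Y) (h3 : H j Y b) : H i X b :=
  h.ent_left (A.isISW.ent_con h1) h2 (h.wit (h.dom h3) (A.con_of_ent_single h1) h3)

theorem left (h : IsApprox A.toWitSystem B.toWitSystem H) {i : A} {X : Finset A} {F : Finset B}
    (hX : A.Con i X) (hF : ∀ b ∈ F, H i X b) :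
    ∃ c U, A.Con c U ∧ A.Ent i X c ∧ A.EntSet i X U ∧ ∀ b ∈ F, H c U b := by
  classical
  choose! U hU1 hU2 hU3 using fun b (hb : b ∈ F) => h.interp_left (hF b hb)
  have hE : A.EntSet i X (F.biUnion U) := by
    intro a ha
    obtain ⟨b, hb, hab⟩ := Finset.mem_biUnion.1 ha
    exact hU2 b hb a hab
  obtain ⟨c, hc1, hc2⟩ := A.isISW.ent_witness hX hE
  refine ⟨c, _, hc2, hc1, hE, fun b hb => h.cons hc2 (A.con_of_ent_single hc1) ?_⟩
  exact h.mono (hU1 b hb) (A.isISW.con_of_ent hX hE) (Finset.subset_biUnion_of_mem U hb)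
    (hU3 b hb)

theorem right (h : IsApprox A.toWitSystem B.toWitSystem H) {i : A} {X : Finset A} {F : Finset B}
    (hX : A.Con i X) (hF : ∀ b ∈ F, H i X b) :
    ∃ e V, B.Con e V ∧ H i X e ∧ (∀ c ∈ V, H i X c) ∧ B.EntSet e V F := by
  classical
  choose! d V h1 h2 h3 h4 using fun b (hb : b ∈ F) => h.interp_right (hF b hb)
  have hE : ∀ c ∈ F.biUnion (fun b => insert (d b) (V b)), H i X c := by
    intro a ha
    obtain ⟨b, hb, hab⟩ := Finset.mem_biUnion.1 ha
    rcases Finset.mem_insert.1 hab with rfl | hab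
    · exact h2 b hb
    · exact h3 b hb a hab
  obtain ⟨e, he1, he2⟩ := h.witness hX hE
  refine ⟨e, _, he2, he1, hE, fun b hb => ?_⟩
  have hsub := Finset.subset_biUnion_of_mem (fun b => insert (d b) (V b)) hb
  have hd : B.Con e {d b} := B.isISW.con_subset (by
    rw [Finset.singleton_subset_iff]; exact hsub (Finset.mem_insert_self _ _)) he2
  exact B.isISW.ent_mono (B.isISW.con_wit hd (h1 b hb)) he2
    ((Finset.subset_insert _ _).trans hsub) (B.isISW.ent_wit hd (h1 b hb) (h4 b hb))

end WitSystem.IsApprox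

namespace ISW

open WitSystem

/-- Morphisms of information systems with witnesses: approximable mappings. -/
@[ext]
structure Hom (A B : ISW.{u}) where
  rel : A → Finset A → B → Prop
  isApprox : IsApprox A.toWitSystem B.toWitSystem rel

/-- Composition in diagrammatic order: first `H`, then `G`. -/
def compRel {A B C : ISW.{u}} (H : A → Finset A → B → Prop) (G : B → Finset B → C → Prop) :
    A → Finset A → C → Prop :=
  fun i X c => ∃ j Y, B.Con j Y ∧ H i X j ∧ (∀ b ∈ Y, H i X b) ∧ G j Y c

theorem isApprox_ent (A : ISW.{u}) : IsApprox A.toWitSystem A.toWitSystem A.Ent := by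
  have gip : ∀ {i X a}, A.Ent i X a →
      ∃ d V, A.Con d V ∧ A.Ent i X d ∧ (∀ c ∈ V, A.Ent i X c) ∧ A.Ent d V a := by
    intro i X a h
    obtain ⟨Z, hZ1, hZ2, hZ3⟩ := A.isISW.ent_interp h
    obtain ⟨e, he1, he2⟩ := A.isISW.ent_witness (A.isISW.ent_con h) hZ2
    exact ⟨e, Z, he2, he1, hZ2, A.isISW.ent_cons (A.con_of_ent_single he1) he2 hZ3⟩
  exact
  { dom := A.isISW.ent_con
    bot := A.isISW.ent_bot _
    mono := A.isISW.ent_mono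
    ent_left := A.isISW.ent_trans
    interp_left := A.isISW.ent_interp
    ent_right := fun _ _ h1 h2 h3 => A.ent_strong h1 h2 h3
    interp_right := gip
    witness := A.isISW.ent_witness
    wit := fun h1 h2 h3 => A.isISW.ent_wit h2 h1 h3
    cons := fun h1 h2 h3 => A.isISW.ent_cons h2 h1 h3 }

theorem isApprox_comp {A B C : ISW.{u}} {H : A → Finset A → B → Prop} {G : B → Finset B → C → Prop}
    (hH : IsApprox A.toWitSystem B.toWitSystem H) (hG : IsApprox B.toWitSystem C.toWitSystem G) :
    IsApprox A.toWitSystem C.toWitSystem (compRel H G) := by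
  classical
  have key : ∀ {i X} {F : Finset C}, A.Con i X → (∀ c ∈ F, compRel H G i X c) →
      ∃ j Y, B.Con j Y ∧ H i X j ∧ (∀ b ∈ Y, H i X b) ∧ ∀ c ∈ F, G j Y c := by
    intro i X F hX hF
    choose! j Y h1 h2 h3 h4 using hF
    have hE : ∀ b ∈ F.biUnion (fun c => insert (j c) (Y c)), H i X b := by
      intro a ha
      obtain ⟨b, hb, hab⟩ := Finset.mem_biUnion.1 ha
      rcases Finset.mem_insert.1 hab with rfl | hab
      · exact h2 b hb
      · exact h3 b hb a hab
    obtain ⟨e, he1, he2⟩ := hH.witness hX hE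
    refine ⟨e, _, he2, he1, hE, fun c hc => ?_⟩
    have hsub := Finset.subset_biUnion_of_mem (fun c => insert (j c) (Y c)) hc
    have hd : B.Con e {j c} := B.isISW.con_subset (by
      rw [Finset.singleton_subset_iff]; exact hsub (Finset.mem_insert_self _ _)) he2
    exact hG.mono (B.isISW.con_wit hd (h1 c hc)) he2
      ((Finset.subset_insert _ _).trans hsub) (hG.wit (h1 c hc) hd (h4 c hc))
  refine ⟨?_, ?_, ?_, ?_, ?_, ?_, ?_, ?_, ?_, ?_⟩
  · rintro i X b ⟨j, Y, -, h, -, -⟩; exact hH.dom h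
  · exact ⟨B.bot, ∅, B.con_empty _, hH.bot, by simp, hG.bot⟩
  · rintro i X X' b hX hX' hs ⟨j, Y, h1, h2, h3, h4⟩
    exact ⟨j, Y, h1, hH.mono hX hX' hs h2, fun b hb => hH.mono hX hX' hs (h3 b hb), h4⟩
  · rintro i X X' b hX hs ⟨j, Y, h1, h2, h3, h4⟩
    exact ⟨j, Y, h1, hH.ent_left hX hs h2, fun b hb => hH.ent_left hX hs (h3 b hb), h4⟩
  · rintro i X b ⟨j, Y, h1, h2, h3, h4⟩
    obtain ⟨c, U, hU, hc, hXU, hb⟩ := hH.left (F := insert j Y) (hH.dom h2) (by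
      intro b hb
      rcases Finset.mem_insert.1 hb with rfl | hb
      · exact h2
      · exact h3 b hb)
    have hci := A.con_of_ent_single hc
    exact ⟨U, A.isISW.con_wit hci hU, hXU, j, Y, h1, hH.wit hU hci (hb j (Finset.mem_insert_self _ _)),
      fun b hb' => hH.wit hU hci (hb b (Finset.mem_insert_of_mem hb')), h4⟩
  · intro i X k Y b hX hY hk hYc hb
    obtain ⟨j, Z, h1, h2, h3, h4⟩ := key (F := insert k Y) hX (by
      intro b hb
      rcases Finset.mem_insert.1 hb with rfl | hb
      · exact hk
      · exact hYc b hb)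
    exact ⟨j, Z, h1, h2, h3, hG.ent_right h1 hY (h4 k (Finset.mem_insert_self _ _))
      (fun c hc => h4 c (Finset.mem_insert_of_mem hc)) hb⟩
  · rintro i X b ⟨j, Y, h1, h2, h3, h4⟩
    obtain ⟨d, V, g1, g2, g3, g4⟩ := hG.interp_right h4
    exact ⟨d, V, g1, ⟨j, Y, h1, h2, h3, g2⟩, fun c hc => ⟨j, Y, h1, h2, h3, g3 c hc⟩, g4⟩
  · intro i X F hX hF
    obtain ⟨j, Z, h1, h2, h3, h4⟩ := key hX hF
    obtain ⟨e, he1, he2⟩ := hG.witness h1 h4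
    exact ⟨e, ⟨j, Z, h1, h2, h3, he1⟩, he2⟩
  · rintro i j X b hX hj ⟨k, Y, h1, h2, h3, h4⟩
    exact ⟨k, Y, h1, hH.wit hX hj h2, fun b hb => hH.wit hX hj (h3 b hb), h4⟩
  · rintro i j X b hX hj ⟨k, Y, h1, h2, h3, h4⟩
    exact ⟨k, Y, h1, hH.cons hX hj h2, fun b hb => hH.cons hX hj (h3 b hb), h4⟩

/-- The category of information systems with witnesses and approximable mappings; `H ≫ G` is the
composition written `H ∘ G` (first `H`, then `G`) in the theory of approximable mappings, and the
identities are the entailment relations. -/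
instance : Category ISW.{u} where
  Hom := Hom
  id A := ⟨A.Ent, A.isApprox_ent⟩
  comp H G := ⟨compRel H.rel G.rel, isApprox_comp H.isApprox G.isApprox⟩
  id_comp := by
    intro A B H
    apply Hom.ext; funext i X b; apply propext; constructor
    · rintro ⟨j, Y, -, h2, h3, h4⟩
      exact H.isApprox.strong h2 h3 h4
    · intro h
      obtain ⟨c, U, h1, h2, h3, h4⟩ :=
        H.isApprox.left (F := {b}) (H.isApprox.dom h) (by simpa using h)
      exact ⟨c, U, h1, h2, h3, h4 b (by simp)⟩
  comp_id := by
    intro A B H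
    apply Hom.ext; funext i X b; apply propext; constructor
    · rintro ⟨j, Y, h1, h2, h3, h4⟩
      exact H.isApprox.ent_right (H.isApprox.dom h2) h1 h2 h3 h4
    · intro h
      obtain ⟨d, V, g1, g2, g3, g4⟩ := H.isApprox.interp_right h
      exact ⟨d, V, g1, g2, g3, g4⟩
  assoc := by
    classical
    intro A B C D H G K
    apply Hom.ext; funext i X d; apply propext; constructor
    · rintro ⟨c, Z, hZ, hc, hcZ, hK⟩
      have hF : ∀ b ∈ insert c Z, compRel H.rel G.rel i X b := by
        intro b hb
        rcases Finset.mem_insert.1 hb with rfl | hb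
        · exact hc
        · exact hcZ b hb
      choose! j Y h1 h2 h3 h4 using hF
      have hE : ∀ b ∈ (insert c Z).biUnion (fun c => insert (j c) (Y c)), H.rel i X b := by
        intro a ha
        obtain ⟨b, hb, hab⟩ := Finset.mem_biUnion.1 ha
        rcases Finset.mem_insert.1 hab with rfl | hab
        · exact h2 b hb
        · exact h3 b hb a hab
      have hX : A.Con i X := H.isApprox.dom (h2 c (Finset.mem_insert_self _ _))
      obtain ⟨e, he1, he2⟩ := H.isApprox.witness hX hE
      have hG : ∀ b ∈ insert c Z,
          G.rel e ((insert c Z).biUnion (fun c => insert (j c) (Y c))) b := by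
        intro b hb
        have hsub := Finset.subset_biUnion_of_mem (fun c => insert (j c) (Y c)) hb
        have hd : B.Con e {j b} := B.isISW.con_subset (by
          rw [Finset.singleton_subset_iff]; exact hsub (Finset.mem_insert_self _ _)) he2
        exact G.isApprox.mono (B.isISW.con_wit hd (h1 b hb)) he2
          ((Finset.subset_insert _ _).trans hsub) (G.isApprox.wit (h1 b hb) hd (h4 b hb))
      exact ⟨e, _, he2, he1, hE, c, Z, hZ, hG c (Finset.mem_insert_self _ _),
        fun b hb => hG b (Finset.mem_insert_of_mem hb), hK⟩
    · rintro ⟨e, Y, hY, he, heY, c, Z, hZ, hc, hcZ, hK⟩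
      exact ⟨c, Z, hZ, ⟨e, Y, hY, he, heY, hc⟩, fun b hb => ⟨e, Y, hY, he, heY, hcZ b hb⟩, hK⟩


/-! Products -/

open scoped Classical in
/-- The product of two systems. -/
noncomputable abbrev prodData (A B : WitSystem.{u}) : WitSystem.{u} where
  carrier := A.carrier × B.carrier
  Con p X := A.Con p.1 (X.image Prod.fst) ∧ B.Con p.2 (X.image Prod.snd)
  Ent p X q := A.Ent p.1 (X.image Prod.fst) q.1 ∧ B.Ent p.2 (X.image Prod.snd) q.2
  bot := (A.bot, B.bot)

open scoped Classical in
/-- For finite sets `X`, `Y` of tokens, a finite set of pairs the projections of which carry the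
same information as `X` and `Y`. It is `X × Y` if both sets are nonempty. As `(i, ∅)` and
`(i, {Δ})` entail the same tokens, an empty factor is first replaced by `{Δ}`; otherwise the
product with an empty set would lose the other factor. -/
noncomputable def box (A B : WitSystem.{u}) (X : Finset A) (Y : Finset B) :
    Finset (A.carrier × B.carrier) :=
  (if X = ∅ then {A.bot} else X) ×ˢ (if Y = ∅ then {B.bot} else Y)

theorem con_pad (A : ISW.{u}) {i : A} {X : Finset A} [Decidable (X = ∅)] (h : A.Con i X) :
    A.Con i (if X = ∅ then {A.bot} else X) := by
  split_ifs
  · exact A.con_bot i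
  · exact h

theorem ent_pad (A : ISW.{u}) {i a : A} {X : Finset A} [Decidable (X = ∅)] (hX : A.Con i X) :
    A.Ent i (if X = ∅ then {A.bot} else X) a ↔ A.Ent i X a := by
  split_ifs with h
  · subst h
    constructor
    · intro h
      refine A.isISW.ent_trans (A.con_empty i) ?_ h
      intro b hb; rw [Finset.mem_singleton] at hb; subst hb; exact A.isISW.ent_bot i
    · exact A.isISW.ent_mono (A.con_empty i) (A.con_bot i) (Finset.empty_subset _)
  · exact Iff.rfl

open scoped Classical in
theorem image_fst_box (A B : WitSystem.{u}) (X : Finset A) (Y : Finset B) :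
    (box A B X Y).image Prod.fst = (if X = ∅ then {A.bot} else X) := by
  rw [box, Finset.product_image_fst]
  split_ifs with h
  · simp
  · exact Finset.nonempty_iff_ne_empty.2 h

open scoped Classical in
theorem image_snd_box (A B : WitSystem.{u}) (X : Finset A) (Y : Finset B) :
    (box A B X Y).image Prod.snd = (if Y = ∅ then {B.bot} else Y) := by
  rw [box, Finset.product_image_snd]
  split_ifs with h
  · simp
  · exact Finset.nonempty_iff_ne_empty.2 h

theorem prodData_isISW (A B : ISW.{u}) : (prodData A.toWitSystem B.toWitSystem).IsISW := by
  classical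
  have hfst : ∀ {p X Y}, (prodData A.toWitSystem B.toWitSystem).EntSet p X Y →
      A.EntSet p.1 (X.image Prod.fst) (Y.image Prod.fst) := by
    intro p X Y h a ha
    obtain ⟨q, hq, rfl⟩ := Finset.mem_image.1 ha
    exact (h q hq).1
  have hsnd : ∀ {p X Y}, (prodData A.toWitSystem B.toWitSystem).EntSet p X Y →
      B.EntSet p.2 (X.image Prod.snd) (Y.image Prod.snd) := by
    intro p X Y h a ha
    obtain ⟨q, hq, rfl⟩ := Finset.mem_image.1 ha
    exact (h q hq).2
  refine ⟨?_, ?_, ?_, ?_, ?_, ?_, ?_, ?_, ?_, ?_, ?_, ?_⟩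
  · exact fun h => ⟨A.isISW.ent_con h.1, B.isISW.ent_con h.2⟩
  · intro i
    refine ⟨?_, ?_⟩
    · rw [Finset.image_singleton]; exact A.isISW.con_self i.1
    · rw [Finset.image_singleton]; exact B.isISW.con_self i.2
  · exact fun h h' => ⟨A.isISW.con_subset (Finset.image_subset_image h) h'.1,
      B.isISW.con_subset (Finset.image_subset_image h) h'.2⟩
  · exact fun i => ⟨A.isISW.ent_bot i.1, B.isISW.ent_bot i.2⟩
  · exact fun h h' => ⟨A.isISW.con_of_ent h.1 (hfst h'), B.isISW.con_of_ent h.2 (hsnd h')⟩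
  · exact fun h h' hs e =>
      ⟨A.isISW.ent_mono h.1 h'.1 (Finset.image_subset_image hs) e.1,
        B.isISW.ent_mono h.2 h'.2 (Finset.image_subset_image hs) e.2⟩
  · exact fun h h' e => ⟨A.isISW.ent_trans h.1 (hfst h') e.1, B.isISW.ent_trans h.2 (hsnd h') e.2⟩
  · rintro i X a ⟨h1, h2⟩
    obtain ⟨Z1, c1, e1, f1⟩ := A.isISW.ent_interp h1
    obtain ⟨Z2, c2, e2, f2⟩ := B.isISW.ent_interp h2
    refine ⟨box A.toWitSystem B.toWitSystem Z1 Z2, ⟨?_, ?_⟩, ?_, ⟨?_, ?_⟩⟩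
    · rw [image_fst_box]; exact A.con_pad c1
    · rw [image_snd_box]; exact B.con_pad c2
    · intro q hq
      replace hq := Finset.mem_product.1 hq
      refine ⟨?_, ?_⟩
      · have := hq.1
        split_ifs at this with h
        · rw [Finset.mem_singleton] at this; rw [this]; exact A.ent_bot' (A.isISW.ent_con h1)
        · exact e1 _ this
      · have := hq.2
        split_ifs at this with h
        · rw [Finset.mem_singleton] at this; rw [this]; exact B.ent_bot' (B.isISW.ent_con h2)
        · exact e2 _ this
    · rw [image_fst_box]; exact (A.ent_pad c1).2 f1
    · rw [image_snd_box]; exact (B.ent_pad c2).2 f2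
  · rintro i X Y ⟨h1, h2⟩ h
    obtain ⟨e1, a1, b1⟩ := A.isISW.ent_witness h1 (hfst h)
    obtain ⟨e2, a2, b2⟩ := B.isISW.ent_witness h2 (hsnd h)
    exact ⟨(e1, e2), ⟨a1, a2⟩, b1, b2⟩
  · rintro i j X ⟨h1, h2⟩ ⟨g1, g2⟩
    rw [Finset.image_singleton] at h1 h2
    exact ⟨A.isISW.con_wit h1 g1, B.isISW.con_wit h2 g2⟩
  · rintro i j X a ⟨h1, h2⟩ ⟨g1, g2⟩ ⟨k1, k2⟩
    rw [Finset.image_singleton] at h1 h2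
    exact ⟨A.isISW.ent_wit h1 g1 k1, B.isISW.ent_wit h2 g2 k2⟩
  · rintro i j X a ⟨h1, h2⟩ ⟨g1, g2⟩ ⟨k1, k2⟩
    rw [Finset.image_singleton] at h1 h2
    exact ⟨A.isISW.ent_cons h1 g1 k1, B.isISW.ent_cons h2 g2 k2⟩

/-- The product of two information systems with witnesses. -/
noncomputable abbrev prod (A B : ISW.{u}) : ISW.{u} :=
  ⟨prodData A.toWitSystem B.toWitSystem, prodData_isISW A B⟩

/-- The pairing of two approximable mappings with a common source. -/
def pair {C A B : ISW.{u}} (F : C ⟶ A) (G : C ⟶ B) : C ⟶ A.prod B where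
  rel i X p := F.rel i X p.1 ∧ G.rel i X p.2
  isApprox := by
    classical
    have hf := F.isApprox
    have hg := G.isApprox
    have im1 : ∀ {i X} {Y : Finset (A.carrier × B.carrier)},
        (∀ q ∈ Y, F.rel i X q.1 ∧ G.rel i X q.2) → ∀ a ∈ Y.image Prod.fst, F.rel i X a := by
      intro i X Y h a ha
      obtain ⟨q, hq, rfl⟩ := Finset.mem_image.1 ha
      exact (h q hq).1
    have im2 : ∀ {i X} {Y : Finset (A.carrier × B.carrier)},
        (∀ q ∈ Y, F.rel i X q.1 ∧ G.rel i X q.2) → ∀ a ∈ Y.image Prod.snd, G.rel i X a := by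
      intro i X Y h a ha
      obtain ⟨q, hq, rfl⟩ := Finset.mem_image.1 ha
      exact (h q hq).2
    have bot1 : ∀ {i X}, C.Con i X → F.rel i X A.bot ∧ G.rel i X B.bot := by
      intro i X h
      have hC := C.con_bot i
      have e1 : C.Ent i X C.bot := C.ent_bot' h
      exact ⟨hf.strong e1 (Y := ∅) (by intro a ha; simp at ha) hf.bot,
        hg.strong e1 (Y := ∅) (by intro a ha; simp at ha) hg.bot⟩
    refine ⟨?_, ?_, ?_, ?_, ?_, ?_, ?_, ?_, ?_, ?_⟩
    · exact fun h => hf.dom h.1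
    · exact ⟨hf.bot, hg.bot⟩
    · exact fun h h' hs e => ⟨hf.mono h h' hs e.1, hg.mono h h' hs e.2⟩
    · exact fun h h' e => ⟨hf.ent_left h h' e.1, hg.ent_left h h' e.2⟩
    · rintro i X b ⟨h1, h2⟩
      obtain ⟨U, a1, a2, a3⟩ := hf.interp_left h1
      obtain ⟨V, b1, b2, b3⟩ := hg.interp_left h2
      have hE : C.EntSet i X (U ∪ V) := by
        intro a ha
        rcases Finset.mem_union.1 ha with h | h
        · exact a2 a h
        · exact b2 a h
      have hc := C.isISW.con_of_ent (hf.dom h1) hE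
      exact ⟨U ∪ V, hc, hE, hf.mono a1 hc Finset.subset_union_left a3,
        hg.mono b1 hc Finset.subset_union_right b3⟩
    · rintro i X k Y b hX ⟨y1, y2⟩ hk hY ⟨e1, e2⟩
      exact ⟨hf.ent_right hX y1 hk.1 (im1 hY) e1, hg.ent_right hX y2 hk.2 (im2 hY) e2⟩
    · rintro i X b ⟨h1, h2⟩
      obtain ⟨d1, V1, c1, e1, f1, g1⟩ := hf.interp_right h1
      obtain ⟨d2, V2, c2, e2, f2, g2⟩ := hg.interp_right h2
      have hb := bot1 (hf.dom h1)
      refine ⟨(d1, d2), box A.toWitSystem B.toWitSystem V1 V2, ⟨?_, ?_⟩, ⟨e1, e2⟩, ?_, ⟨?_, ?_⟩⟩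
      · rw [image_fst_box]; exact A.con_pad c1
      · rw [image_snd_box]; exact B.con_pad c2
      · intro q hq
        replace hq := Finset.mem_product.1 hq
        refine ⟨?_, ?_⟩
        · have := hq.1
          split_ifs at this with h
          · rw [Finset.mem_singleton] at this; rw [this]; exact hb.1
          · exact f1 _ this
        · have := hq.2
          split_ifs at this with h
          · rw [Finset.mem_singleton] at this; rw [this]; exact hb.2
          · exact f2 _ this
      · rw [image_fst_box]; exact (A.ent_pad c1).2 g1
      · rw [image_snd_box]; exact (B.ent_pad c2).2 g2
    · intro i X F' hX hF
      obtain ⟨e1, a1, b1⟩ := hf.witness hX (im1 hF)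
      obtain ⟨e2, a2, b2⟩ := hg.witness hX (im2 hF)
      exact ⟨(e1, e2), ⟨a1, a2⟩, b1, b2⟩
    · exact fun h1 h2 h3 => ⟨hf.wit h1 h2 h3.1, hg.wit h1 h2 h3.2⟩
    · exact fun h1 h2 h3 => ⟨hf.cons h1 h2 h3.1, hg.cons h1 h2 h3.2⟩

theorem isApprox_of_proj (P A : ISW.{u}) (f : P → A) (g : Finset P → Finset A)
    (hbot : f P.bot = A.bot) (hempty : g ∅ = ∅)
    (hsing : ∀ i, g {i} = {f i})
    (hmono : ∀ X Y, X ⊆ Y → g X ⊆ g Y)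
    (hcon : ∀ i X, P.Con i X → A.Con (f i) (g X))
    (hent : ∀ i X Y, P.EntSet i X Y → A.EntSet (f i) (g X) (g Y))
    (hinterp : ∀ i X a, P.Con i X → A.Ent (f i) (g X) a →
      ∃ Z, P.Con i Z ∧ P.EntSet i X Z ∧ A.Ent (f i) (g Z) a) :
    IsApprox P.toWitSystem A.toWitSystem (fun i X a => P.Con i X ∧ A.Ent (f i) (g X) a) := by
  have hA := A.isApprox_ent
  refine ⟨?_, ?_, ?_, ?_, ?_, ?_, ?_, ?_, ?_, ?_⟩
  · exact fun h => h.1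
  · refine ⟨P.con_empty _, ?_⟩
    rw [hbot, hempty]; exact A.isISW.ent_bot _
  · exact fun h h' hs e => ⟨h', hA.mono (hcon _ _ h) (hcon _ _ h') (hmono _ _ hs) e.2⟩
  · exact fun h h' e => ⟨h, hA.ent_left (hcon _ _ h) (hent _ _ _ h') e.2⟩
  · rintro i X b ⟨h1, h2⟩
    obtain ⟨Z, a1, a2, a3⟩ := hinterp i X b h1 h2
    exact ⟨Z, a1, a2, a1, a3⟩
  · exact fun h h' e1 e2 e3 =>
      ⟨h, hA.ent_right (hcon _ _ h) h' e1.2 (fun c hc => (e2 c hc).2) e3⟩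
  · rintro i X b ⟨h1, h2⟩
    obtain ⟨d, V, a1, a2, a3, a4⟩ := hA.interp_right h2
    exact ⟨d, V, a1, ⟨h1, a2⟩, fun c hc => ⟨h1, a3 c hc⟩, a4⟩
  · intro i X F h hF
    obtain ⟨e, a1, a2⟩ := hA.witness (hcon _ _ h) (fun c hc => (hF c hc).2)
    exact ⟨e, ⟨h, a1⟩, a2⟩
  · intro i j X b h h' e
    have := hcon _ _ h'
    rw [hsing] at this
    exact ⟨P.isISW.con_wit h' h, hA.wit (hcon _ _ h) this e.2⟩
  · intro i j X b h h' e
    have := hcon _ _ h'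
    rw [hsing] at this
    exact ⟨h, hA.cons (hcon _ _ h) this e.2⟩

open scoped Classical in
/-- The first projection of a product. -/
noncomputable def fst (A B : ISW.{u}) : A.prod B ⟶ A where
  rel p X a := (A.prod B).Con p X ∧ A.Ent p.1 (X.image Prod.fst) a
  isApprox := by
    apply isApprox_of_proj (A.prod B) A (fun p => p.1) (fun X => X.image Prod.fst)
    · rfl
    · rfl
    · intro i; exact Finset.image_singleton _ _
    · intro X Y h; exact Finset.image_subset_image h
    · exact fun i X h => h.1
    · intro i X Y h a ha
      obtain ⟨q, hq, rfl⟩ := Finset.mem_image.1 ha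
      exact (h q hq).1
    · intro i X a h e
      obtain ⟨Z, h1, h2, h3⟩ := (A.prod B).isISW.ent_interp (i := i) (X := X) (a := (a, B.bot))
        ⟨e, B.ent_bot' h.2⟩
      exact ⟨Z, h1, h2, h3.1⟩

open scoped Classical in
/-- The second projection of a product. -/
noncomputable def snd (A B : ISW.{u}) : A.prod B ⟶ B where
  rel p X b := (A.prod B).Con p X ∧ B.Ent p.2 (X.image Prod.snd) b
  isApprox := by
    apply isApprox_of_proj (A.prod B) B (fun p => p.2) (fun X => X.image Prod.snd)
    · rfl
    · rfl
    · intro i; exact Finset.image_singleton _ _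
    · intro X Y h; exact Finset.image_subset_image h
    · exact fun i X h => h.2
    · intro i X Y h a ha
      obtain ⟨q, hq, rfl⟩ := Finset.mem_image.1 ha
      exact (h q hq).2
    · intro i X b h e
      obtain ⟨Z, h1, h2, h3⟩ := (A.prod B).isISW.ent_interp (i := i) (X := X) (a := (A.bot, b))
        ⟨A.ent_bot' h.1, e⟩
      exact ⟨Z, h1, h2, h3.2⟩

theorem pair_fst {C A B : ISW.{u}} (F : C ⟶ A) (G : C ⟶ B) : pair F G ≫ fst A B = F := by
  classical
  apply Hom.ext; funext i X a; apply propext; constructor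
  · rintro ⟨j, Y, h1, h2, h3, h4⟩
    refine F.isApprox.ent_right (F.isApprox.dom h2.1) h1.1 h2.1 ?_ h4.2
    intro a ha
    obtain ⟨q, hq, rfl⟩ := Finset.mem_image.1 ha
    exact (h3 q hq).1
  · intro h
    have hX := F.isApprox.dom h
    have hb : G.rel i X B.bot :=
      G.isApprox.strong (C.ent_bot' hX) (Y := ∅) (by intro a ha; simp at ha) G.isApprox.bot
    obtain ⟨d, V, g1, g2, g3, g4⟩ := (pair F G).isApprox.interp_right (b := (a, B.bot)) ⟨h, hb⟩
    exact ⟨d, V, g1, g2, g3, g1, g4.1⟩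

theorem pair_snd {C A B : ISW.{u}} (F : C ⟶ A) (G : C ⟶ B) : pair F G ≫ snd A B = G := by
  classical
  apply Hom.ext; funext i X a; apply propext; constructor
  · rintro ⟨j, Y, h1, h2, h3, h4⟩
    refine G.isApprox.ent_right (G.isApprox.dom h2.2) h1.2 h2.2 ?_ h4.2
    intro a ha
    obtain ⟨q, hq, rfl⟩ := Finset.mem_image.1 ha
    exact (h3 q hq).2
  · intro h
    have hX := G.isApprox.dom h
    have hb : F.rel i X A.bot :=
      F.isApprox.strong (C.ent_bot' hX) (Y := ∅) (by intro a ha; simp at ha) F.isApprox.bot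
    obtain ⟨d, V, g1, g2, g3, g4⟩ := (pair F G).isApprox.interp_right (b := (A.bot, a)) ⟨hb, h⟩
    exact ⟨d, V, g1, g2, g3, g1, g4.2⟩

theorem pair_eta {C A B : ISW.{u}} (H : C ⟶ A.prod B) :
    pair (H ≫ fst A B) (H ≫ snd A B) = H := by
  classical
  apply Hom.ext; funext i X p; apply propext; constructor
  · rintro ⟨⟨j, Y, h1, h2, h3, h4⟩, ⟨j', Y', h1', h2', h3', h4'⟩⟩
    have hX := H.isApprox.dom h2
    obtain ⟨T, hj, hj', hY, hY', hT⟩ : ∃ T : Finset (A.prod B), j ∈ T ∧ j' ∈ T ∧ Y ⊆ T ∧ Y' ⊆ T ∧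
        ∀ c ∈ T, H.rel i X c := by
      refine ⟨insert j (insert j' (Y ∪ Y')), by simp, by simp, fun c hc => by simp [hc],
        fun c hc => by simp [hc], ?_⟩
      intro c hc
      simp only [Finset.mem_insert, Finset.mem_union] at hc
      rcases hc with rfl | rfl | hc | hc
      · exact h2
      · exact h2'
      · exact h3 c hc
      · exact h3' c hc
    obtain ⟨e, he1, he2⟩ := H.isApprox.witness hX hT
    refine H.isApprox.ent_right (k := e) (Y := T) hX he2 he1 hT ⟨?_, ?_⟩
    · have hj : A.Con e.1 {j.1} := A.isISW.con_subset (by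
        rw [Finset.singleton_subset_iff]; exact Finset.mem_image_of_mem _ hj) he2.1
      exact A.isISW.ent_mono (A.isISW.con_wit hj h1.1) he2.1 (Finset.image_subset_image hY)
        (A.isISW.ent_wit hj h1.1 h4.2)
    · have hj : B.Con e.2 {j'.2} := B.isISW.con_subset (by
        rw [Finset.singleton_subset_iff]; exact Finset.mem_image_of_mem _ hj') he2.2
      exact B.isISW.ent_mono (B.isISW.con_wit hj h1'.2) he2.2 (Finset.image_subset_image hY')
        (B.isISW.ent_wit hj h1'.2 h4'.2)
  · intro h
    obtain ⟨d, V, g1, g2, g3, g4⟩ := H.isApprox.interp_right h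
    exact ⟨⟨d, V, g1, g2, g3, g1, g4.1⟩, ⟨d, V, g1, g2, g3, g1, g4.2⟩⟩

/-- `A.prod B` with its projections is the categorical product. -/
theorem prod_isProduct (A B : ISW.{u}) :
    Nonempty (Limits.IsLimit (Limits.BinaryFan.mk (fst A B) (snd A B))) :=
  ⟨Limits.BinaryFan.isLimitMk (fun s => pair (Limits.BinaryFan.fst s) (Limits.BinaryFan.snd s))
    (fun s => pair_fst _ _) (fun s => pair_snd _ _)
    (fun s m h1 h2 => by rw [← pair_eta m, h1, h2])⟩

/-- `F × G` for approximable mappings `F` and `G`. -/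
noncomputable def prodMap {A A' B B' : ISW.{u}} (F : A ⟶ A') (G : B ⟶ B') :
    A.prod B ⟶ A'.prod B' :=
  pair (fst A B ≫ F) (snd A B ≫ G)

open scoped Classical in
theorem prodMap_rel {A A' B B' : ISW.{u}} (F : A ⟶ A') (G : B ⟶ B') (p : A.prod B)
    (X : Finset (A.prod B)) (q : A'.prod B') :
    (prodMap F G).rel p X q ↔
      F.rel p.1 (X.image Prod.fst) q.1 ∧ G.rel p.2 (X.image Prod.snd) q.2 := by
  constructor
  · rintro ⟨⟨j, Y, h1, h2, h3, h4⟩, ⟨j', Y', h1', h2', h3', h4'⟩⟩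
    exact ⟨F.isApprox.strong h2.2 (fun b hb => (h3 b hb).2) h4,
      G.isApprox.strong h2'.2 (fun b hb => (h3' b hb).2) h4'⟩
  · rintro ⟨h1, h2⟩
    have hX : (A.prod B).Con p X := ⟨F.isApprox.dom h1, G.isApprox.dom h2⟩
    obtain ⟨c, U, a1, a2, a3, a4⟩ := F.isApprox.left (F := {q.1}) (F.isApprox.dom h1)
      (by simpa using h1)
    obtain ⟨d, V, b1, b2, b3, b4⟩ := G.isApprox.left (F := {q.2}) (G.isApprox.dom h2)
      (by simpa using h2)
    exact ⟨⟨c, U, a1, ⟨hX, a2⟩, fun b hb => ⟨hX, a3 b hb⟩, a4 _ (by simp)⟩,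
      ⟨d, V, b1, ⟨hX, b2⟩, fun b hb => ⟨hX, b3 b hb⟩, b4 _ (by simp)⟩⟩

end ISW

namespace WitSystem

/-- `X`-equivalence of witnesses, `i ~ j [X]`: there is a chain `i = a₀, a₁, …, aₙ = j` with `n ≥ 1`
such that `X` is consistent with witness `a_ν` for all `ν`, and for every `ν` the tokens `a_ν` and
`a_{ν+1}` have a common witness. (So `i ~ i [X]` exactly if `X ∈ Con(i)`.) -/
def WitEq (A : WitSystem.{u}) (X : Finset A) : A → A → Prop :=
  Relation.TransGen fun a b => A.Con a X ∧ A.Con b X ∧ ∃ k, A.Con k {a} ∧ A.Con k {b}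

/-- Elements `(i, X)`, where `X` is a finite set of tokens. -/
abbrev Pt (A : WitSystem.{u}) : Type u := A.carrier × Finset A.carrier

/-- Elements `((i, X), c)`. -/
abbrev Step (A B : WitSystem.{u}) : Type u := Pt A × B.carrier

section FunctionSpace

variable {A B : WitSystem.{u}}

open scoped Classical

/-- `pr₁(V)`. -/
noncomputable def dom (V : Finset (Step A B)) : Finset (Pt A) := V.image Prod.fst

/-- `pr₂(V)`. -/
noncomputable def ran (V : Finset (Step A B)) : Finset B := V.image Prod.snd

/-- `⋃ pr₂(𝔛)`. -/
noncomputable def supp (𝔛 : Finset (Pt A)) : Finset A := 𝔛.biUnion Prod.snd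

/-- `Cl((a, S), 𝔛)`. -/
noncomputable def cl (a : A) (S : Finset A) (𝔛 : Finset (Pt A)) : Finset (Pt A) :=
  𝔛.filter fun x => ∃ j, A.WitEq x.2 x.1 j ∧ A.Ent a S j ∧ A.EntSet a S x.2

/-- `W(𝔛)`. -/
def wset (𝔛 : Finset (Pt A)) : Set A :=
  {a | A.Con a (supp 𝔛) ∧ ∀ x ∈ 𝔛, A.WitEq x.2 a x.1}

/-- `(a, U)` is `V`-maximal. -/
def Maximal (V : Finset (Step A B)) (a : A) (U : Finset (Step A B)) : Prop :=
  U ⊆ V ∧ a ∈ wset (dom U) ∧ ∀ p ∈ V, p.1.2 ⊆ supp (dom U) → A.WitEq p.1.2 a p.1.1 → p ∈ U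

/-- `R` is a choice of systems of representatives of `W(pr₁(J))` with respect to
`~ [⋃ pr₂(pr₁(J))]`, for all `J ⊆ V`. -/
structure IsReprSystem (V : Finset (Step A B)) (R : Finset (Pt A) → Set A) : Prop where
  sub : ∀ J ⊆ V, R (dom J) ⊆ wset (dom J)
  repr : ∀ J ⊆ V, ∀ a ∈ wset (dom J), ∃! r, r ∈ R (dom J) ∧ A.WitEq (supp (dom J)) a r
  empty : R ∅ = {A.bot}
  single : ∀ x ∈ dom V, R {x} = {x.1}

/-- The set of tokens that has to be consistent with the witness attached to `(e, J)`, where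
`W` is the set constructed up to the previous stage. -/
def toWitness (V : Finset (Step A B)) (R : Finset (Pt A) → Set A) (W : Set (Step A B)) (e : A)
    (J : Finset (Step A B)) : Set B :=
  {t | ∃ a : A, ∃ K ⊆ V, supp (dom K) ⊆ supp (dom J) ∧ A.WitEq (supp (dom K)) a e ∧
    ((K.card = 1 ∧ ((a, supp (dom K)), t) ∈ V) ∨
      (a ∈ R (dom K) ∧ ((a, supp (dom K)), t) ∈ W))}

/-- `T ∈ Con(j)` for a set `T` of tokens (which is in particular required to be finite). -/
def ConSet (B : WitSystem.{u}) (j : B) (T : Set B) : Prop :=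
  ∃ F : Finset B, (F : Set B) = T ∧ B.Con j F

/-- `W` is an associate of `V`. -/
def IsAssociate (V : Finset (Step A B)) (W : Set (Step A B)) : Prop :=
  (∀ p ∈ W, A.Con p.1.1 p.1.2) ∧
  ∃ R : Finset (Pt A) → Set A, IsReprSystem V R ∧
  ∃ chain : ℕ → Set (Step A B), Monotone chain ∧ W = ⋃ κ, chain κ ∧
    chain 0 = (if Maximal V A.bot ∅ then {((A.bot, ∅), B.bot)} else ∅) ∧
    ∀ κ, ∃ W' : Set (Step A B), chain (κ + 1) = chain κ ∪ W' ∧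
      (∀ J ⊆ V, J.card = κ + 1 → ∀ e ∈ R (dom J), Maximal V e J →
        ∃! j : B, B.ConSet j (toWitness V R (chain κ) e J) ∧ ((e, supp (dom J)), j) ∈ W') ∧
      ∀ p ∈ W', ∃ J ⊆ V, J.card = κ + 1 ∧ p.1.1 ∈ R (dom J) ∧ Maximal V p.1.1 J ∧
        p.1.2 = supp (dom J) ∧ B.ConSet p.2 (toWitness V R (chain κ) p.1.1 J)

variable (A B) in
/-- The tokens of the function space: pairs `⟨W | V⟩` of a finite subset `V` of `Con × A'` and an
associate `W` of `V`. -/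
structure FunTok : Type u where
  W : Set (Step A B)
  V : Finset (Step A B)
  con : ∀ p ∈ V, A.Con p.1.1 p.1.2
  assoc : IsAssociate V W

/-- The spectrum `sp((a, S), V)`. -/
noncomputable def sp (a : A) (S : Finset A) (V : Finset (Step A B)) : Finset (Step A B) :=
  V.filter fun p => A.WitEq p.1.2 a p.1.1 ∧ p.1.2 ⊆ S

/-- `ds((a, S), V) = pr₁(sp((a, S), V))`. -/
noncomputable def ds (a : A) (S : Finset A) (V : Finset (Step A B)) : Finset (Pt A) :=
  dom (sp a S V)

/-- `rs((a, S), V) = pr₂(sp((a, S), V))`. -/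
noncomputable def rs (a : A) (S : Finset A) (V : Finset (Step A B)) : Finset B :=
  ran (sp a S V)

/-- The set of all elements of `V` the first component of which is in `Cl((a, S), pr₁(V))`. -/
noncomputable def active (a : A) (S : Finset A) (V : Finset (Step A B)) : Finset (Step A B) :=
  V.filter fun p => p.1 ∈ cl a S (dom V)

/-- `ap((a, S), V)`. -/
noncomputable def ap (a : A) (S : Finset A) (V : Finset (Step A B)) : Finset B :=
  ran (active a S V)

/-- The pair `q = (e, j)` is selected by `⟨W | V⟩` at `(a, S)`: with
`T = ⋃ pr₂(Cl((a, S), pr₁(V)))`, the token `e` is in `W(Cl((a, S), pr₁(V)))`, `a ~ e [T]`,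
`ap((a, S), V) ∈ Con'(j)` and `((e, T), j) ∈ W`. -/
def Selects (V : Finset (Step A B)) (W : Set (Step A B)) (a : A) (S : Finset A)
    (q : A.carrier × B.carrier) : Prop :=
  q.1 ∈ wset (dom (active a S V)) ∧ A.WitEq (supp (dom (active a S V))) a q.1 ∧
    B.Con q.2 (ap a S V) ∧ ((q.1, supp (dom (active a S V))), q.2) ∈ W

end FunctionSpace

end WitSystem

namespace ISW

open WitSystem

section Selection

variable {A B : ISW.{u}}

theorem witEq_symm {X : Finset A} {i j : A} (h : A.WitEq X i j) : A.WitEq X j i := by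
  induction h with
  | single h => exact .single ⟨h.2.1, h.1, h.2.2.imp fun k hk => ⟨hk.2, hk.1⟩⟩
  | tail _ h ih => exact .head ⟨h.2.1, h.1, h.2.2.imp fun k hk => ⟨hk.2, hk.1⟩⟩ ih

theorem witEq_mono {X U : Finset A} {i j : A} (hU : U ⊆ X) (h : A.WitEq X i j) :
    A.WitEq U i j :=
  Relation.TransGen.mono
    (fun _ _ h => ⟨A.isISW.con_subset hU h.1, A.isISW.con_subset hU h.2.1, h.2.2⟩) _ _ h

theorem witEq_of_con {X : Finset A} {i j : A} (h : A.Con j {i}) (hX : A.Con i X) :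
    A.WitEq X i j :=
  .single ⟨hX, A.isISW.con_wit h hX, j, h, A.isISW.con_self j⟩

theorem witEq_bot (i : A) : A.WitEq ∅ i A.bot :=
  .single ⟨A.con_empty i, A.con_empty _, i, A.isISW.con_self i, A.con_bot i⟩

theorem mem_dom {V : Finset (Step A.toWitSystem B.toWitSystem)} {x : Pt A.toWitSystem} :
    x ∈ dom V ↔ ∃ p ∈ V, p.1 = x := by
  classical
  simp [dom]

theorem subset_supp {U : Finset (Step A.toWitSystem B.toWitSystem)}
    {p : Step A.toWitSystem B.toWitSystem} (hp : p ∈ U) : p.1.2 ⊆ supp (dom U) := by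
  classical
  exact Finset.subset_biUnion_of_mem (s := dom U) Prod.snd (mem_dom.2 ⟨p, hp, rfl⟩)

theorem mem_active {V : Finset (Step A.toWitSystem B.toWitSystem)} {a : A} {S : Finset A}
    {p : Step A.toWitSystem B.toWitSystem} : p ∈ active a S V ↔
      p ∈ V ∧ ∃ j, A.WitEq p.1.2 p.1.1 j ∧ A.Ent a S j ∧ A.EntSet a S p.1.2 := by
  classical
  simp only [active, cl, Finset.mem_filter]
  constructor
  · rintro ⟨h1, -, h3⟩; exact ⟨h1, h3⟩
  · rintro ⟨h1, h3⟩; exact ⟨h1, mem_dom.2 ⟨p, h1, rfl⟩, h3⟩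

theorem entSet_supp_active {V : Finset (Step A.toWitSystem B.toWitSystem)} {a : A}
    {S : Finset A} : A.EntSet a S (supp (dom (active a S V))) := by
  classical
  intro b hb
  obtain ⟨x, hx, hbx⟩ := Finset.mem_biUnion.1 hb
  obtain ⟨p, hp, rfl⟩ := mem_dom.1 hx
  obtain ⟨-, j, -, -, h⟩ := mem_active.1 hp
  exact h b hbx

theorem maximal_active {V : Finset (Step A.toWitSystem B.toWitSystem)} {a : A} {S : Finset A}
    (hS : A.Con a S) : Maximal V a (active a S V) := by
  classical
  refine ⟨Finset.filter_subset _ _, ⟨A.isISW.con_of_ent hS entSet_supp_active, ?_⟩, ?_⟩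
  · intro x hx
    obtain ⟨p, hp, rfl⟩ := mem_dom.1 hx
    obtain ⟨-, j, h1, h2, h3⟩ := mem_active.1 hp
    have hj : A.Con j p.1.2 := by
      cases h1 with
      | single h => exact h.2.1
      | tail _ h => exact h.2.1
    exact (witEq_symm (witEq_of_con (A.con_of_ent_single h2) hj)).trans (witEq_symm h1)
  · intro p hp h1 h2
    have hE : A.EntSet a S p.1.2 := fun b hb => entSet_supp_active b (h1 hb)
    obtain ⟨e, he1, he2⟩ := A.isISW.ent_witness hS hE
    exact mem_active.2 ⟨hp, e, (witEq_symm h2).trans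
      (witEq_symm (witEq_of_con (A.con_of_ent_single he1) he2)), he1, hE⟩

theorem maximal_congr {V U : Finset (Step A.toWitSystem B.toWitSystem)} {a c : A}
    (h : Maximal V a U) (hc : A.WitEq (supp (dom U)) a c) : Maximal V c U := by
  refine ⟨h.1, ⟨?_, fun x hx => ?_⟩, fun p hp h1 h2 => ?_⟩
  · cases hc with
    | single h => exact h.2.1
    | tail _ h => exact h.2.1
  · obtain ⟨p, hp, rfl⟩ := mem_dom.1 hx
    exact (witEq_symm (witEq_mono (subset_supp hp) hc)).trans (h.2.1.2 _ hx)
  · exact h.2.2 p hp h1 ((witEq_mono h1 hc).trans h2)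

theorem maximal_subset {V U U' : Finset (Step A.toWitSystem B.toWitSystem)} {a c : A}
    (h : Maximal V a U) (h' : Maximal V c U') (hs : supp (dom U) ⊆ supp (dom U'))
    (hc : A.WitEq (supp (dom U)) a c) : U ⊆ U' := by
  intro p hp
  exact h'.2.2 p (h.1 hp) ((subset_supp hp).trans hs)
    ((witEq_symm (witEq_mono (subset_supp hp) hc)).trans (h.2.1.2 _ (mem_dom.2 ⟨p, hp, rfl⟩)))

/-- Every token of the function space selects exactly one pair at every `(a, S) ∈ Con`. -/
theorem existsUnique_selects (w : FunTok A.toWitSystem B.toWitSystem) {a : A} {S : Finset A}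
    (hS : A.Con a S) : ∃! q, Selects w.V w.W a S q := by
  classical
  obtain ⟨-, R, hR, chain, hmono, hW, h0, hstep⟩ := w.assoc
  rw [hW]
  generalize w.V = V at *
  choose W' hW'1 hW'2 hW'3 using hstep
  set M := active a S V with hMdef
  have hM : Maximal V a M := maximal_active hS
  obtain ⟨r, ⟨hr1, hr2⟩, hr3⟩ := hR.repr M hM.1 a hM.2.1
  have hrM : Maximal V r M := maximal_congr hM hr2
  have hchain : ∀ κ, ∀ q ∈ chain κ, q ∈ chain 0 ∨ ∃ ν, q ∈ W' ν := by
    intro κ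
    induction κ with
    | zero => exact fun q hq => Or.inl hq
    | succ κ ih =>
      intro q hq
      rw [hW'1] at hq
      rcases hq with hq | hq
      · exact ih q hq
      · exact Or.inr ⟨κ, hq⟩
  have huniq : ∀ q ∈ ⋃ κ, chain κ, q.1.2 = supp (dom M) → A.WitEq (supp (dom M)) a q.1.1 →
      q.1.1 = r ∧ ((M = ∅ ∧ q.2 = B.bot) ∨ ∃ κ, M.card = κ + 1 ∧ q ∈ W' κ ∧
        B.ConSet q.2 (toWitness V R (chain κ) q.1.1 M)) := by
    intro q hq hq1 hq2
    obtain ⟨κ, hκ⟩ := Set.mem_iUnion.1 hq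
    rcases hchain κ q hκ with hq0 | ⟨ν, hν⟩
    · rw [h0] at hq0
      split_ifs at hq0 with hmax
      · rw [Set.mem_singleton_iff] at hq0
        subst hq0
        have hJ : M = ∅ := Finset.subset_empty.1
          (maximal_subset hM hmax (by rw [← hq1]; exact Finset.empty_subset _) hq2)
        rw [hJ] at hr1
        have : R (dom (∅ : Finset (Step A.toWitSystem B.toWitSystem))) = {A.bot} := hR.empty
        rw [this] at hr1
        exact ⟨hr1.symm, Or.inl ⟨hJ, rfl⟩⟩
      · exact absurd hq0 (Set.notMem_empty _)
    · obtain ⟨J, hJ, hJc, hJR, hJm, hJs, hJw⟩ := hW'3 ν q hν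
      have hs : supp (dom J) = supp (dom M) := hJs.symm.trans hq1
      have hJM : J = M := Finset.Subset.antisymm
        (maximal_subset hJm hM hs.le (by rw [hs]; exact witEq_symm hq2))
        (maximal_subset hM hJm hs.ge hq2)
      rw [hJM] at hJc hJR hJw
      exact ⟨hr3 _ ⟨hJR, hq2⟩, Or.inr ⟨ν, hJc, hν, hJw⟩⟩
  rcases Nat.eq_zero_or_pos M.card with hc | hc
  · have hM0 : M = ∅ := Finset.card_eq_zero.1 hc
    have hrb : r = A.bot := by
      rw [hM0] at hr1
      have : R (dom (∅ : Finset (Step A.toWitSystem B.toWitSystem))) = {A.bot} := hR.empty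
      rw [this] at hr1; exact hr1
    refine ⟨(r, B.bot), ⟨hrM.2.1, hr2, ?_, ?_⟩, ?_⟩
    · have : ap a S V = ∅ := by rw [ap, ← hMdef, hM0]; rfl
      change B.Con B.bot (ap a S V)
      rw [this]; exact B.con_empty _
    · refine Set.mem_iUnion.2 ⟨0, ?_⟩
      have : supp (dom M) = ∅ := by rw [hM0]; rfl
      rw [h0]
      change ((r, supp (dom M)), B.bot) ∈ _
      rw [this, hrb, if_pos (by rw [← hrb, ← hM0]; exact hrM)]
      rfl
    · rintro ⟨e, j⟩ ⟨g1, g2, g3, g4⟩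
      obtain ⟨k1, ⟨-, k2⟩ | ⟨κ, k2, -⟩⟩ := huniq _ g4 rfl g2
      · exact Prod.ext k1 k2
      · omega
  · obtain ⟨κ, hκ⟩ : ∃ κ, M.card = κ + 1 := ⟨M.card - 1, by omega⟩
    obtain ⟨j, ⟨hj1, hj2⟩, hj3⟩ := hW'2 κ M hM.1 hκ r hr1 hrM
    refine ⟨(r, j), ⟨hrM.2.1, hr2, ?_, ?_⟩, ?_⟩
    · obtain ⟨F, hF, hFc⟩ := hj1
      refine B.isISW.con_subset ?_ hFc
      intro b hb
      obtain ⟨p, hp, rfl⟩ := Finset.mem_image.1 hb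
      rw [← Finset.mem_coe, hF]
      have hd : dom ({p} : Finset (Step A.toWitSystem B.toWitSystem)) = {p.1} :=
        Finset.image_singleton _ _
      have hs : supp (dom ({p} : Finset (Step A.toWitSystem B.toWitSystem))) = p.1.2 := by
        rw [hd]; exact Finset.singleton_biUnion
      refine ⟨p.1.1, {p}, Finset.singleton_subset_iff.2 (hM.1 hp), ?_, ?_, Or.inl ⟨rfl, ?_⟩⟩
      · rw [hs]; exact subset_supp hp
      · rw [hs]; exact witEq_symm (hrM.2.1.2 _ (mem_dom.2 ⟨p, hp, rfl⟩))
      · rw [hs]; exact hM.1 hp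
    · refine Set.mem_iUnion.2 ⟨κ + 1, ?_⟩
      rw [hW'1]; exact Or.inr hj2
    · rintro ⟨e, i⟩ ⟨g1, g2, g3, g4⟩
      obtain ⟨k1, ⟨k2, -⟩ | ⟨ν, k2, k3, k4⟩⟩ := huniq _ g4 rfl g2
      · rw [k2] at hκ; simp at hκ
      · obtain rfl : ν = κ := by omega
        obtain rfl : e = r := k1
        exact Prod.ext rfl (hj3 i ⟨k4, k3⟩)

end Selection

open scoped Classical in
/-- `W₂(a, S)`, for a token `w = ⟨W | V⟩` of the function space and `(a, S) ∈ Con`: the second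
component of the unique pair selected by `w` at `(a, S)`. -/
noncomputable def sel {A B : ISW.{u}} (w : FunTok A.toWitSystem B.toWitSystem) (a : A)
    (S : Finset A) : B :=
  if h : A.Con a S then (existsUnique_selects w h).choose.2 else B.bot

/-- The token `⟨{((Δ, ∅), Δ')} | ∅⟩`. -/
def botTok (A B : ISW.{u}) : FunTok A.toWitSystem B.toWitSystem where
  W := {((A.bot, ∅), B.bot)}
  V := ∅
  con := by simp
  assoc := by
    classical
    have hd : dom (∅ : Finset (Step A.toWitSystem B.toWitSystem)) = ∅ := rfl
    have hs : supp (∅ : Finset (Pt A.toWitSystem)) = ∅ := rfl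
    refine ⟨?_, fun _ => {A.bot}, ⟨?_, ?_, rfl, ?_⟩, fun _ => {((A.bot, ∅), B.bot)}, fun _ _ _ => le_rfl,
      (Set.iUnion_const _).symm, ?_, fun κ => ⟨∅, (Set.union_empty _).symm, ?_, ?_⟩⟩
    · intro p hp
      rw [Set.mem_singleton_iff] at hp; subst hp; exact A.con_empty _
    · intro J hJ a ha
      rw [Finset.subset_empty.1 hJ, hd, Set.mem_singleton_iff.1 ha]
      exact ⟨by rw [hs]; exact A.con_empty _, by simp⟩
    · intro J hJ a ha
      rw [Finset.subset_empty.1 hJ, hd, hs]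
      exact ⟨A.bot, ⟨rfl, witEq_bot a⟩, fun y hy => hy.1⟩
    · intro x hx; rw [hd] at hx; simp at hx
    · rw [if_pos]
      refine ⟨Finset.Subset.refl _, ⟨?_, ?_⟩, by simp⟩
      · rw [hd, hs]; exact A.con_empty _
      · rw [hd]; simp
    · intro J hJ hc
      rw [Finset.subset_empty.1 hJ] at hc; simp at hc
    · intro p hp; exact absurd hp (Set.notMem_empty _)

open scoped Classical in
/-- `⋃ 𝒱` for a finite set `⟨𝒲 | 𝒱⟩` of tokens of the function space. -/
noncomputable def steps {A B : ISW.{u}} (F : Finset (FunTok A.toWitSystem B.toWitSystem)) :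
    Finset (Step A.toWitSystem B.toWitSystem) :=
  F.biUnion FunTok.V

/-- The consistency relation of the function space. -/
def funCon (A B : ISW.{u}) (w : FunTok A.toWitSystem B.toWitSystem)
    (F : Finset (FunTok A.toWitSystem B.toWitSystem)) : Prop :=
  ∀ (a : A) (S : Finset A), A.Con a S →
    (∀ g ∈ F, ∃ k, B.WitEq (ap a S g.V) (sel g a S) k ∧ B.Con (sel w a S) {k}) ∧
    ∀ r, B.WitEq (ap a S w.V) r (sel w a S) → B.WitEq (ap a S (steps F)) r (sel w a S)

open scoped Classical in
/-- The entailment relation of the function space. -/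
def funEnt (A B : ISW.{u}) (w : FunTok A.toWitSystem B.toWitSystem)
    (F : Finset (FunTok A.toWitSystem B.toWitSystem))
    (x : FunTok A.toWitSystem B.toWitSystem) : Prop :=
  funCon A B w F ∧
  (∀ p ∈ x.V, B.Ent (sel w p.1.1 p.1.2) (ap p.1.1 p.1.2 (steps F)) p.2) ∧
  ∀ q ∈ x.W, ∃ k, B.WitEq (rs q.1.1 q.1.2 x.V) q.2 k ∧
    B.Ent (sel w q.1.1 q.1.2)
      ((ds q.1.1 q.1.2 x.V).biUnion fun y => ap y.1 y.2 (steps F)) k ∧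
    B.EntSet (sel w q.1.1 q.1.2)
      ((ds q.1.1 q.1.2 x.V).biUnion fun y => ap y.1 y.2 (steps F)) (rs q.1.1 q.1.2 x.V)

/-- The function space `A → B`. -/
abbrev funSpaceData (A B : ISW.{u}) : WitSystem.{u} where
  carrier := FunTok A.toWitSystem B.toWitSystem
  Con := funCon A B
  Ent := funEnt A B
  bot := botTok A B

open scoped Classical in
/-- The evaluation relation `Ev` between `(A → B) × A` and `B`. -/
def evRel (A B : ISW.{u}) :
    (prodData (funSpaceData A B) A.toWitSystem) →
      Finset (prodData (funSpaceData A B) A.toWitSystem) → B → Prop :=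
  fun p Z b => (prodData (funSpaceData A B) A.toWitSystem).Con p Z ∧
    B.Ent (sel p.1 p.2 (Z.image Prod.snd))
      (ap p.2 (Z.image Prod.snd) (steps (Z.image Prod.fst))) b

/-- The currying `Λ(H)` of a relation `H` between `A × A'` and `A''`. -/
def lamRel {A A' A'' : ISW.{u}} (H : A.prod A' → Finset (A.prod A') → A'' → Prop) :
    A → Finset A → funSpaceData A' A'' → Prop :=
  fun a S x => A.Con a S ∧
    (∀ p ∈ x.V, H (a, p.1.1) (box A.toWitSystem A'.toWitSystem S p.1.2) p.2) ∧
    ∀ q ∈ x.W, ∃ j, H (a, q.1.1) (box A.toWitSystem A'.toWitSystem S q.1.2) j ∧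
      A''.WitEq (rs q.1.1 q.1.2 x.V) j q.2

/-- The information system `E` together with `ev : E × A ⇒ A'` is the exponent of `A` and `A'`
in the category of information systems with witnesses. -/
def IsExponent (A A' E : ISW.{u}) (ev : E.prod A ⟶ A') : Prop :=
  ∀ (C : ISW.{u}) (H : C.prod A ⟶ A'), ∃! G : C ⟶ E, prodMap G (𝟙 A) ≫ ev = H

end ISW

/-! A consistent pair `(w, F)` of the function space stands for the approximable mapping `valueRel w
F` from `A` to `B`: at `(a, S)` the value of `w` serves as witness, and the outputs of the steps of
`F` active there form the finite set from which tokens are entailed. A token x lies below an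
approximable f (`Below f x`) if its steps belong to f and each pair of its associate has a second
component equivalent, relative to the relevant outputs, to a value of f. The pivot is `funEnt_iff`:
`(w, F)` entails x exactly when `w` witnesses `F` and x is below `valueRel w F`. The axioms of the
function space thereby become statements about tokens below an approximable mapping.

Four facts about such an f carry the argument. Every finite set of steps in f has an associate below
f (`exists_tok`); it is built by recursion on the number of steps, the witness property of f
supplying each new value. Finitely many tokens below f have a witness below f
(`exists_witness_below`). Finitely many pairs of f are recovered from a single token below f
(`exists_tok_valueRel`). A token below g is below any approximable f contained in g as soon as f
contains its steps (`Below.of_steps`), so interpolation only has to care for finitely many steps.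
Conversely, consistent tokens below f represent a relation contained in f (`rel_of_valueRel`).

Fixing the first argument of H at `(c, S)` gives an approximable mapping, and `lamRel H` relates
`(c, S)` to exactly the tokens below it, while `evRel` is `valueRel` at the two projections. The
same facts thus give approximability of both and the equations `prodMap_curry_comp_ev` and
`lamRel_comp_ev`. The first is existence of the transpose; the second, applied to an arbitrary
solution, is uniqueness. -/

namespace ISW

open WitSystem

/-! ### Equivalence of witnesses and the information order on consistent pairs -/

section Witnesses

variable {A B : ISW.{u}}

theorem con_of_witEq_left {X : Finset A} {i j : A} (h : A.WitEq X i j) : A.Con i X := by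
  induction h with
  | single h => exact h.1
  | tail _ _ ih => exact ih

theorem con_of_witEq_right {X : Finset A} {i j : A} (h : A.WitEq X i j) : A.Con j X :=
  con_of_witEq_left (witEq_symm h)

theorem witEq_refl {X : Finset A} {i : A} (h : A.Con i X) : A.WitEq X i i :=
  witEq_of_con (A.isISW.con_self i) h

/-- Two neighbours in the chain share a witness k: `wit` carries the value up to k, and `cons`
brings it down to the other neighbour. -/
theorem rel_of_witEq {H : A → Finset A → B → Prop}
    (hH : IsApprox A.toWitSystem B.toWitSystem H) {X : Finset A} {i j : A} {b : B}
    (h : A.WitEq X i j) (hb : H i X b) : H j X b := by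
  induction h with
  | single h =>
    obtain ⟨h1, h2, k, hk1, hk2⟩ := h
    exact hH.cons h2 hk2 (hH.wit h1 hk1 hb)
  | tail _ h ih =>
    obtain ⟨h1, h2, k, hk1, hk2⟩ := h
    exact hH.cons h2 hk2 (hH.wit h1 hk1 ih)

theorem ent_of_witEq {X : Finset A} {i j b : A} (h : A.WitEq X i j) (hb : A.Ent i X b) :
    A.Ent j X b :=
  rel_of_witEq A.isApprox_ent h hb

/-- Values of an approximable mapping at the same argument are equivalent with respect to every
set that is consistent with both of them. -/
theorem witEq_of_rel {H : A → Finset A → B → Prop}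
    (hH : IsApprox A.toWitSystem B.toWitSystem H) {i : A} {X : Finset A} {k l : B} {Y : Finset B}
    (hk : H i X k) (hl : H i X l) (hkY : B.Con k Y) (hlY : B.Con l Y) : B.WitEq Y k l := by
  classical
  obtain ⟨e, -, he⟩ := hH.witness (F := {k, l}) (hH.dom hk) (by
    intro c hc
    rcases Finset.mem_insert.1 hc with rfl | hc
    · exact hk
    · rw [Finset.mem_singleton.1 hc]; exact hl)
  have h1 : B.Con e {k} := B.isISW.con_subset (by simp) he
  have h2 : B.Con e {l} := B.isISW.con_subset (by simp) he
  exact (witEq_of_con h1 hkY).trans (witEq_symm (witEq_of_con h2 hlY))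

/-- `(i, X)` carries at most the information of `(a, S)`. -/
def InfoLe (A : ISW.{u}) (i : A) (X : Finset A) (a : A) (S : Finset A) : Prop :=
  ∀ b, A.Ent i X b → A.Ent a S b

theorem InfoLe.trans {i a c : A} {X S T : Finset A} (h : InfoLe A i X a S)
    (h' : InfoLe A a S c T) : InfoLe A i X c T :=
  fun b hb => h' b (h b hb)

theorem infoLe_of_witEq {X : Finset A} {i j : A} (h : A.WitEq X i j) : InfoLe A i X j X :=
  fun _ hb => ent_of_witEq h hb

theorem infoLe_of_subset {X S : Finset A} {a : A} (hS : A.Con a S) (h : X ⊆ S) :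
    InfoLe A a X a S :=
  fun _ hb => A.isISW.ent_mono (A.isISW.ent_con hb) hS h hb

theorem infoLe_of_entSet {X S : Finset A} {a : A} (hS : A.Con a S) (h : A.EntSet a S X) :
    InfoLe A a X a S :=
  fun _ hb => A.isISW.ent_trans hS h hb

theorem infoLe_of_ent {X S : Finset A} {a i : A} (h : A.Ent a S i) (hX : A.EntSet a S X) :
    InfoLe A i X a S :=
  fun _ hb => A.ent_strong h hX hb

/-- A witness e of `Y` entailed by `(i, X)` is entailed by `(a, S)` too, so e links i to a. -/
theorem InfoLe.witEq {i a : A} {X S Y : Finset A} (h : InfoLe A i X a S) (hX : A.Con i X)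
    (hY : A.EntSet i X Y) : A.WitEq Y i a := by
  obtain ⟨e, he, heY⟩ := A.isISW.ent_witness hX hY
  exact (witEq_symm (witEq_of_con (A.con_of_ent_single he) heY)).trans
    (witEq_of_con (A.con_of_ent_single (h e he)) heY)

theorem witEq_of_entSet {i j : A} {X Y : Finset A} (h : A.WitEq X i j) (hY : A.EntSet i X Y) :
    A.WitEq Y i j :=
  (infoLe_of_witEq h).witEq (con_of_witEq_left h) hY

/-- By left interpolation the value depends only on finitely many tokens entailed by `(i, X)`, and
`(a, S)` entails those as well. All monotonicity properties of approximable mappings are thus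
instances of one. -/
theorem rel_of_infoLe {H : A → Finset A → B → Prop}
    (hH : IsApprox A.toWitSystem B.toWitSystem H) {i a : A} {X S : Finset A} {b : B}
    (h : InfoLe A i X a S) (hb : H i X b) : H a S b := by
  obtain ⟨c, U, -, hc, hU, hcb⟩ := hH.left (F := {b}) (hH.dom hb) (by simpa using hb)
  exact hH.strong (h c hc) (fun d hd => h d (hU d hd)) (hcb b (by simp))

end Witnesses

/-! ### Active steps, spectra and their monotonicity -/

section Steps

open scoped Classical

variable {A B : ISW.{u}}

theorem witEq_of_mem_active {V : Finset (Step A.toWitSystem B.toWitSystem)} {a : A} {S : Finset A}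
    (hS : A.Con a S) {p : Step A.toWitSystem B.toWitSystem} (hp : p ∈ active a S V) :
    A.WitEq p.1.2 a p.1.1 :=
  (maximal_active hS).2.1.2 _ (mem_dom.2 ⟨p, hp, rfl⟩)

theorem infoLe_of_mem_active {V : Finset (Step A.toWitSystem B.toWitSystem)} {a : A} {S : Finset A}
    (hS : A.Con a S) {p : Step A.toWitSystem B.toWitSystem} (hp : p ∈ active a S V) :
    InfoLe A p.1.1 p.1.2 a S :=
  (infoLe_of_witEq (witEq_symm (witEq_of_mem_active hS hp))).trans
    (infoLe_of_entSet hS (mem_active.1 hp).2.choose_spec.2.2)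

theorem infoLe_of_mem_sp {V : Finset (Step A.toWitSystem B.toWitSystem)} {a : A} {S : Finset A}
    (hS : A.Con a S) {p : Step A.toWitSystem B.toWitSystem} (hp : p ∈ sp a S V) :
    InfoLe A p.1.1 p.1.2 a S :=
  (infoLe_of_witEq (witEq_symm (Finset.mem_filter.1 hp).2.1)).trans
    (infoLe_of_subset hS (Finset.mem_filter.1 hp).2.2)

theorem active_mono {V V' : Finset (Step A.toWitSystem B.toWitSystem)} {i a : A}
    {X S : Finset A} (hV : V ⊆ V') (h : InfoLe A i X a S) : active i X V ⊆ active a S V' := by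
  intro p hp
  obtain ⟨hp, j, h1, h2, h3⟩ := mem_active.1 hp
  exact mem_active.2 ⟨hV hp, j, h1, h j h2, fun b hb => h b (h3 b hb)⟩

theorem ap_mono {V V' : Finset (Step A.toWitSystem B.toWitSystem)} {i a : A}
    {X S : Finset A} (hV : V ⊆ V') (h : InfoLe A i X a S) : ap i X V ⊆ ap a S V' :=
  Finset.image_subset_image (active_mono hV h)

theorem mem_ap {V : Finset (Step A.toWitSystem B.toWitSystem)} {a : A} {S : Finset A} {c : B} :
    c ∈ ap a S V ↔ ∃ p ∈ active a S V, p.2 = c :=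
  Finset.mem_image

theorem mem_rs {V : Finset (Step A.toWitSystem B.toWitSystem)} {a : A} {S : Finset A} {c : B} :
    c ∈ rs a S V ↔ ∃ p ∈ sp a S V, p.2 = c :=
  Finset.mem_image

theorem mem_steps {F : Finset (FunTok A.toWitSystem B.toWitSystem)}
    {p : Step A.toWitSystem B.toWitSystem} : p ∈ steps F ↔ ∃ x ∈ F, p ∈ x.V :=
  Finset.mem_biUnion

theorem steps_singleton (x : FunTok A.toWitSystem B.toWitSystem) : steps {x} = x.V :=
  Finset.singleton_biUnion

theorem steps_mono {F G : Finset (FunTok A.toWitSystem B.toWitSystem)} (h : F ⊆ G) :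
    steps F ⊆ steps G :=
  Finset.biUnion_subset_biUnion_of_subset_left _ h

theorem subset_steps {F : Finset (FunTok A.toWitSystem B.toWitSystem)}
    {x : FunTok A.toWitSystem B.toWitSystem} (h : x ∈ F) : x.V ⊆ steps F :=
  Finset.subset_biUnion_of_mem FunTok.V h

theorem rel_of_mem_ap {f : A → Finset A → B → Prop}
    (hf : IsApprox A.toWitSystem B.toWitSystem f)
    {V : Finset (Step A.toWitSystem B.toWitSystem)} (hV : ∀ p ∈ V, f p.1.1 p.1.2 p.2)
    {a : A} {S : Finset A} (hS : A.Con a S) : ∀ c ∈ ap a S V, f a S c := by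
  intro c hc
  obtain ⟨p, hp, rfl⟩ := mem_ap.1 hc
  exact rel_of_infoLe hf (infoLe_of_mem_active hS hp) (hV p (mem_active.1 hp).1)

theorem rel_of_mem_rs {f : A → Finset A → B → Prop}
    (hf : IsApprox A.toWitSystem B.toWitSystem f)
    {V : Finset (Step A.toWitSystem B.toWitSystem)} (hV : ∀ p ∈ V, f p.1.1 p.1.2 p.2)
    {a : A} {S : Finset A} (hS : A.Con a S) : ∀ c ∈ rs a S V, f a S c := by
  intro c hc
  obtain ⟨p, hp, rfl⟩ := mem_rs.1 hc
  exact rel_of_infoLe hf (infoLe_of_mem_sp hS hp) (hV p (Finset.mem_filter.1 hp).1)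

/-- This connects the two ways of collecting outputs: the spectrum compares by inclusion, activity
by entailment, and the active steps form a maximal set. Hence `rs` at the selected pair of an
associate equals `ap` at the original argument. -/
theorem sp_eq_of_maximal {V M : Finset (Step A.toWitSystem B.toWitSystem)} {e : A}
    (h : Maximal V e M) : sp e (supp (dom M)) V = M := by
  ext p
  constructor
  · intro hp
    obtain ⟨h1, h2, h3⟩ := Finset.mem_filter.1 hp
    exact h.2.2 p h1 h3 h2
  · intro hp
    exact Finset.mem_filter.2
      ⟨h.1 hp, h.2.1.2 _ (mem_dom.2 ⟨p, hp, rfl⟩), subset_supp hp⟩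

end Steps

/-! ### Values of a token and their growth with the argument -/

section Values

open scoped Classical

variable {A B : ISW.{u}}

theorem selects_sel (w : FunTok A.toWitSystem B.toWitSystem) {a : A} {S : Finset A}
    (hS : A.Con a S) : ∃ e, Selects w.V w.W a S (e, sel w a S) := by
  refine ⟨(existsUnique_selects w hS).choose.1, ?_⟩
  rw [sel, dif_pos hS]
  exact (existsUnique_selects w hS).choose_spec.1

/-- The pair of the associate that determines the value of a token at `(a, S)`. -/
theorem exists_mem_assoc (w : FunTok A.toWitSystem B.toWitSystem) {a : A} {S : Finset A}
    (hS : A.Con a S) : ∃ e T, ((e, T), sel w a S) ∈ w.W ∧ A.WitEq T e a ∧ InfoLe A e T a S ∧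
      rs e T w.V = ap a S w.V := by
  obtain ⟨e, -, he2, -, he4⟩ := selects_sel w hS
  refine ⟨e, _, he4, witEq_symm he2, (infoLe_of_witEq (witEq_symm he2)).trans
    (infoLe_of_entSet hS entSet_supp_active), ?_⟩
  rw [rs, sp_eq_of_maximal (maximal_congr (maximal_active hS) he2), ap]

theorem con_sel_ap (w : FunTok A.toWitSystem B.toWitSystem) {a : A} {S : Finset A}
    (hS : A.Con a S) : B.Con (sel w a S) (ap a S w.V) :=
  (selects_sel w hS).choose_spec.2.2.1

/-- Selection depends only on the set of active steps and on the class of the witness relative to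
its support; uniqueness of the selected pair does the rest. -/
theorem sel_eq_of_active {w : FunTok A.toWitSystem B.toWitSystem} {i a : A} {X S : Finset A}
    (hX : A.Con i X) (hS : A.Con a S) (hM : active i X w.V = active a S w.V)
    (hw : A.WitEq (supp (dom (active a S w.V))) i a) : sel w i X = sel w a S := by
  obtain ⟨e, he⟩ := selects_sel w hX
  obtain ⟨c, hc⟩ := selects_sel w hS
  have : Selects w.V w.W a S (e, sel w i X) := by
    obtain ⟨h1, h2, h3, h4⟩ := he
    rw [ap] at h3
    rw [hM] at h1 h2 h3 h4
    exact ⟨h1, (witEq_symm hw).trans h2, h3, h4⟩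
  exact congrArg Prod.snd ((existsUnique_selects w hS).unique this hc)

theorem sel_congr (w : FunTok A.toWitSystem B.toWitSystem) {i a : A} {X S : Finset A}
    (hX : A.Con i X) (hS : A.Con a S) (h : InfoLe A i X a S)
    (hM : active a S w.V ⊆ active i X w.V) : sel w i X = sel w a S := by
  have hM' := (active_mono (Finset.Subset.refl w.V) h).antisymm hM
  refine sel_eq_of_active hX hS hM' ?_
  rw [← hM']
  exact h.witEq hX entSet_supp_active

/-- The values of a token of the function space increase with the argument. -/
theorem con_sel_of_infoLe (w : FunTok A.toWitSystem B.toWitSystem) {i a : A} {X S : Finset A}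
    (hX : A.Con i X) (hS : A.Con a S) (h : InfoLe A i X a S) :
    B.Con (sel w a S) {sel w i X} := by
  -- With the same active steps the values coincide. Otherwise `(a, S)` activates strictly more
  -- steps, so its value was attached at a later stage, where the earlier value was already among
  -- the tokens to be witnessed.
  by_cases hMM : active a S w.V ⊆ active i X w.V
  · rw [sel_congr w hX hS h hMM]; exact B.isISW.con_self _
  have hsub := active_mono (Finset.Subset.refl w.V) h
  have hlt : (active i X w.V).card < (active a S w.V).card :=
    Finset.card_lt_card (Finset.ssubset_iff_subset_ne.2 ⟨hsub, fun h => hMM h.ge⟩)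
  obtain ⟨e, -, he2, -, he4⟩ := selects_sel w hX
  obtain ⟨c, -, hc2, -, hc4⟩ := selects_sel w hS
  have hw : A.WitEq (supp (dom (active i X w.V))) i a := h.witEq hX entSet_supp_active
  have hss : supp (dom (active i X w.V)) ⊆ supp (dom (active a S w.V)) :=
    Finset.biUnion_subset_biUnion_of_subset_left _ (Finset.image_subset_image hsub)
  dsimp only at he2 he4 hc2 hc4
  obtain ⟨-, R, hR, chain, hmono, hW, h0, hstep⟩ := w.assoc
  rw [hW] at he4 hc4
  choose W' hW'1 hW'2 hW'3 using hstep
  have hchain : ∀ κ, ∀ q ∈ chain κ, q ∈ chain 0 ∨ ∃ ν, q ∈ W' ν := by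
    intro κ
    induction κ with
    | zero => exact fun q hq => Or.inl hq
    | succ κ ih =>
      intro q hq
      rw [hW'1] at hq
      rcases hq with hq | hq
      · exact ih q hq
      · exact Or.inr ⟨κ, hq⟩
  -- By maximality the class of e and the support determine the set of steps, so a pair over them is
  -- either the initial one or was added at the stage given by the cardinality of M.
  have key : ∀ (x : A) (M : Finset (Step A.toWitSystem B.toWitSystem)) (e : A) (j : B),
      Maximal w.V x M → A.WitEq (supp (dom M)) x e → ((e, supp (dom M)), j) ∈ ⋃ κ, chain κ →
      (M = ∅ ∧ j = B.bot) ∨ ∃ κ, M.card = κ + 1 ∧ e ∈ R (dom M) ∧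
        ((e, supp (dom M)), j) ∈ W' κ ∧ B.ConSet j (toWitness w.V R (chain κ) e M) := by
    intro x M e j hM hxe hq
    obtain ⟨κ, hκ⟩ := Set.mem_iUnion.1 hq
    rcases hchain κ _ hκ with hq0 | ⟨ν, hν⟩
    · rw [h0] at hq0
      split_ifs at hq0 with hmax
      · have hq0 := Set.mem_singleton_iff.1 hq0
        have h1 : e = A.bot := congrArg (fun p => p.1.1) hq0
        have h2 : supp (dom M) = ∅ := congrArg (fun p => p.1.2) hq0
        have h3 : j = B.bot := congrArg (fun p => p.2) hq0
        rw [h1] at hxe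
        exact Or.inl ⟨Finset.subset_empty.1
          (maximal_subset hM hmax (by rw [h2]; exact Finset.empty_subset _) hxe), h3⟩
      · exact absurd hq0 (Set.notMem_empty _)
    · obtain ⟨J, hJ, hJc, hJR, hJm, hJs, hJw⟩ := hW'3 ν _ hν
      dsimp only at hJR hJm hJs hJw
      have hJM : J = M := Finset.Subset.antisymm
        (maximal_subset hJm hM hJs.ge (by rw [← hJs]; exact witEq_symm hxe))
        (maximal_subset hM hJm hJs.le hxe)
      rw [hJM] at hJc hJR hJw
      exact Or.inr ⟨ν, hJc, hJR, hν, hJw⟩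
  rcases key i _ e _ (maximal_active hX) he2 he4 with ⟨-, h2⟩ | ⟨κ, h1, h2, h3, -⟩
  · rw [h2]; exact B.con_bot _
  rcases key a _ c _ (maximal_active hS) hc2 hc4 with ⟨g1, -⟩ | ⟨ν, g1, -, -, F, hF, hFc⟩
  · rw [g1] at hlt; simp at hlt
  refine B.isISW.con_subset ?_ hFc
  rw [Finset.singleton_subset_iff, ← Finset.mem_coe, hF]
  refine ⟨e, _, (maximal_active hX).1, hss,
    (witEq_symm he2).trans (hw.trans (witEq_mono hss hc2)), Or.inr ⟨h2, ?_⟩⟩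
  -- The sets of active steps have κ + 1 and ν + 1 elements, the first strictly fewer; the pair
  -- added at stage κ + 1 is therefore present in the set from which stage ν + 1 is formed.
  refine hmono (show κ + 1 ≤ ν by omega) ?_
  rw [hW'1]
  exact Or.inr h3

end Values

/-! ### Existence of associates below an approximable mapping -/

section Construction

open scoped Classical

variable {A B : ISW.{u}}

/-- A system of representatives of the equivalence classes `~ [⋃ pr₂(𝔛)]` of `W(𝔛)`. -/
noncomputable def reprs (A : ISW.{u}) (𝔛 : Finset (Pt A.toWitSystem)) : Set A :=
  if 𝔛 = ∅ then {A.bot} else if h : ∃ x, 𝔛 = {x} then {h.choose.1} else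
    {r | ∃ a ∈ wset 𝔛, r = Classical.epsilon (A.WitEq (supp 𝔛) a)}

theorem reprs_empty (A : ISW.{u}) : reprs A ∅ = {A.bot} := if_pos rfl

theorem reprs_singleton (A : ISW.{u}) (x : Pt A.toWitSystem) : reprs A {x} = {x.1} := by
  have h : ∃ y, ({x} : Finset (Pt A.toWitSystem)) = {y} := ⟨x, rfl⟩
  rw [reprs, if_neg (Finset.singleton_ne_empty x), dif_pos h,
    ← Finset.singleton_injective h.choose_spec]

theorem supp_singleton (x : Pt A.toWitSystem) : supp {x} = x.2 :=
  Finset.singleton_biUnion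

theorem mem_wset_of_witEq {𝔛 : Finset (Pt A.toWitSystem)} {a r : A} (ha : a ∈ wset 𝔛)
    (h : A.WitEq (supp 𝔛) a r) : r ∈ wset 𝔛 :=
  ⟨con_of_witEq_right h, fun x hx =>
    (witEq_symm (witEq_mono (Finset.subset_biUnion_of_mem Prod.snd hx) h)).trans (ha.2 x hx)⟩

theorem reprs_spec {𝔛 : Finset (Pt A.toWitSystem)} (h𝔛 : ∀ x ∈ 𝔛, A.Con x.1 x.2) :
    reprs A 𝔛 ⊆ wset 𝔛 ∧
      ∀ a ∈ wset 𝔛, ∃! r, r ∈ reprs A 𝔛 ∧ A.WitEq (supp 𝔛) a r := by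
  by_cases h0 : 𝔛 = ∅
  · subst h0
    rw [reprs_empty]
    refine ⟨?_, fun a _ => ⟨A.bot, ⟨rfl, witEq_bot a⟩, fun y hy => hy.1⟩⟩
    intro a ha
    rw [Set.mem_singleton_iff.1 ha]
    exact ⟨A.con_empty _, by simp⟩
  by_cases h1 : ∃ x, 𝔛 = {x}
  · obtain ⟨x, rfl⟩ := h1
    have hx := h𝔛 x (Finset.mem_singleton_self x)
    rw [reprs_singleton]
    refine ⟨?_, fun a ha => ⟨x.1, ⟨rfl, ?_⟩, fun y hy => hy.1⟩⟩
    · intro a ha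
      rw [Set.mem_singleton_iff.1 ha]
      refine ⟨by rw [supp_singleton]; exact hx, fun y hy => ?_⟩
      rw [Finset.mem_singleton.1 hy]
      exact witEq_refl hx
    · rw [supp_singleton]
      exact ha.2 x (Finset.mem_singleton_self x)
  rw [reprs, if_neg h0, dif_neg h1]
  have hε : ∀ a ∈ wset 𝔛, A.WitEq (supp 𝔛) a (Classical.epsilon (A.WitEq (supp 𝔛) a)) :=
    fun a ha => Classical.epsilon_spec (p := A.WitEq (supp 𝔛) a) ⟨a, witEq_refl ha.1⟩
  refine ⟨?_, fun a ha => ⟨_, ⟨⟨a, ha, rfl⟩, hε a ha⟩, ?_⟩⟩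
  · rintro r ⟨a, ha, rfl⟩
    exact mem_wset_of_witEq ha (hε a ha)
  · rintro r ⟨⟨c, hc, rfl⟩, har⟩
    have hac : A.WitEq (supp 𝔛) a c := har.trans (witEq_symm (hε c hc))
    -- Equivalent tokens define the same predicate, and `Classical.epsilon` depends on the predicate
    -- only, so each class has a single representative.
    have : A.WitEq (supp 𝔛) a = A.WitEq (supp 𝔛) c := by
      funext d
      exact propext ⟨fun h => (witEq_symm hac).trans h, fun h => hac.trans h⟩
    rw [this]

theorem isReprSystem_reprs {V : Finset (Step A.toWitSystem B.toWitSystem)}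
    (hV : ∀ p ∈ V, A.Con p.1.1 p.1.2) : IsReprSystem V (reprs A) := by
  have h : ∀ J ⊆ V, ∀ x ∈ dom J, A.Con x.1 x.2 := by
    intro J hJ x hx
    obtain ⟨p, hp, rfl⟩ := mem_dom.1 hx
    exact hV p (hJ hp)
  exact ⟨fun J hJ => (reprs_spec (h J hJ)).1, fun J hJ => (reprs_spec (h J hJ)).2,
    reprs_empty A, fun x _ => reprs_singleton A x⟩

/-- The witness chosen for `(e, J)` from the values of `f`. -/
noncomputable def chosen (f : A → Finset A → B → Prop)
    (V : Finset (Step A.toWitSystem B.toWitSystem))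
    (W : Set (Step A.toWitSystem B.toWitSystem)) (e : A)
    (J : Finset (Step A.toWitSystem B.toWitSystem)) : B :=
  Classical.epsilon fun j =>
    f e (supp (dom J)) j ∧ B.ConSet j (toWitness V (reprs A) W e J)

/-- The pairs added at stage `κ` of the construction of an associate. -/
def stage (f : A → Finset A → B → Prop) (V : Finset (Step A.toWitSystem B.toWitSystem))
    (W : Set (Step A.toWitSystem B.toWitSystem)) (κ : ℕ) :
    Set (Step A.toWitSystem B.toWitSystem) :=
  {p | ∃ J ⊆ V, J.card = κ ∧ p.1.1 ∈ reprs A (dom J) ∧ Maximal V p.1.1 J ∧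
    p.1.2 = supp (dom J) ∧ p.2 = chosen f V W p.1.1 J}

/-- The chain the union of which is an associate of `V`. -/
noncomputable def assocChain (f : A → Finset A → B → Prop)
    (V : Finset (Step A.toWitSystem B.toWitSystem)) :
    ℕ → Set (Step A.toWitSystem B.toWitSystem)
  | 0 => if Maximal V A.bot ∅ then {((A.bot, ∅), B.bot)} else ∅
  | κ + 1 => assocChain f V κ ∪ stage f V (assocChain f V κ) (κ + 1)

/-- There are finitely many K, for each at most one representative is equivalent to e, and over one
argument `W` has finitely many values. Finiteness is needed because consistency is defined for
finite sets only. -/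
theorem finite_toWitness {V : Finset (Step A.toWitSystem B.toWitSystem)}
    {W : Set (Step A.toWitSystem B.toWitSystem)} (hV : ∀ p ∈ V, A.Con p.1.1 p.1.2)
    (hW : ∀ x, {t | (x, t) ∈ W}.Finite) (e : A)
    {J : Finset (Step A.toWitSystem B.toWitSystem)} :
    (toWitness V (reprs A) W e J).Finite := by
  have hR := isReprSystem_reprs hV
  have h1 : {t : B | ∃ x, (x, t) ∈ V}.Finite := by
    refine (V.image Prod.snd).finite_toSet.subset ?_
    rintro t ⟨x, hx⟩
    exact Finset.mem_coe.2 (Finset.mem_image.2 ⟨_, hx, rfl⟩)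
  have h2 : (⋃ K ∈ V.powerset, {t : B | ∃ a, A.WitEq (supp (dom K)) a e ∧
      a ∈ reprs A (dom K) ∧ ((a, supp (dom K)), t) ∈ W}).Finite := by
    refine V.powerset.finite_toSet.biUnion fun K hK => ?_
    have hK := Finset.mem_powerset.1 (Finset.mem_coe.1 hK)
    by_cases h : ∃ a, A.WitEq (supp (dom K)) a e ∧ a ∈ reprs A (dom K)
    · obtain ⟨a, ha1, ha2⟩ := h
      refine (hW (a, supp (dom K))).subset ?_
      rintro t ⟨c, hc1, hc2, hc3⟩
      have hac := (hR.repr K hK a (hR.sub K hK ha2)).unique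
        ⟨ha2, witEq_refl (con_of_witEq_left ha1)⟩ ⟨hc2, ha1.trans (witEq_symm hc1)⟩
      rw [hac]
      exact hc3
    · refine Set.Finite.subset Set.finite_empty ?_
      rintro t ⟨c, hc1, hc2, -⟩
      exact h ⟨c, hc1, hc2⟩
  refine (h1.union h2).subset ?_
  rintro t ⟨a, K, hK, -, hae, ⟨-, h⟩ | ⟨h, h'⟩⟩
  · exact Or.inl ⟨_, h⟩
  · exact Or.inr (Set.mem_iUnion₂.2 ⟨K, Finset.mem_powerset.2 hK, a, hae, h, h'⟩)

/-- Monotonicity makes every token to be witnessed a value of f at `(e, supp (dom J))`; the witness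
property of f then yields a value of f that witnesses them all. -/
theorem chosen_spec {f : A → Finset A → B → Prop} (hf : IsApprox A.toWitSystem B.toWitSystem f)
    {V : Finset (Step A.toWitSystem B.toWitSystem)} (hV : ∀ p ∈ V, f p.1.1 p.1.2 p.2)
    {W : Set (Step A.toWitSystem B.toWitSystem)} (hW : ∀ x, {t | (x, t) ∈ W}.Finite)
    (hWf : ∀ q ∈ W, f q.1.1 q.1.2 q.2) {e : A}
    {J : Finset (Step A.toWitSystem B.toWitSystem)} (he : A.Con e (supp (dom J))) :
    f e (supp (dom J)) (chosen f V W e J) ∧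
      B.ConSet (chosen f V W e J) (toWitness V (reprs A) W e J) := by
  have hfin := finite_toWitness (fun p hp => hf.dom (hV p hp)) hW e (J := J)
  refine Classical.epsilon_spec
    (p := fun j => f e (supp (dom J)) j ∧ B.ConSet j (toWitness V (reprs A) W e J)) ?_
  obtain ⟨j, h1, h2⟩ := hf.witness (F := hfin.toFinset) he (by
    intro c hc
    obtain ⟨a, K, -, hs, hae, h⟩ := hfin.mem_toFinset.1 hc
    have ha : f a (supp (dom K)) c := by
      rcases h with ⟨-, h⟩ | ⟨-, h⟩
      · exact hV _ h
      · exact hWf _ h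
    exact hf.mono (con_of_witEq_right hae) he hs (rel_of_witEq hf hae ha))
  exact ⟨j, h1, _, hfin.coe_toFinset, h2⟩

/-- The two invariants have to be carried together: finiteness over each argument and containment in
f are both needed for the witnesses of the next stage to exist. -/
theorem assocChain_spec {f : A → Finset A → B → Prop}
    (hf : IsApprox A.toWitSystem B.toWitSystem f)
    {V : Finset (Step A.toWitSystem B.toWitSystem)} (hV : ∀ p ∈ V, f p.1.1 p.1.2 p.2) (κ : ℕ) :
    (∀ x, {t | (x, t) ∈ assocChain f V κ}.Finite) ∧
      ∀ q ∈ assocChain f V κ, f q.1.1 q.1.2 q.2 := by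
  induction κ with
  | zero =>
    rw [assocChain]
    split_ifs with h
    · refine ⟨fun x => (Set.finite_singleton B.bot).subset ?_, ?_⟩
      · intro t ht
        exact congrArg Prod.snd (Set.mem_singleton_iff.1 ht)
      · intro q hq
        rw [Set.mem_singleton_iff.1 hq]
        exact hf.bot
    · exact ⟨fun x => Set.Finite.subset Set.finite_empty fun t ht => ht, fun q hq => hq.elim⟩
  | succ κ ih =>
    rw [assocChain]
    refine ⟨fun x => ?_, ?_⟩
    · refine ((ih.1 x).union ((V.powerset.image
        (chosen f V (assocChain f V κ) x.1)).finite_toSet)).subset ?_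
      rintro t (ht | ⟨J, hJ, -, -, -, -, h⟩)
      · exact Or.inl ht
      · exact Or.inr (Finset.mem_coe.2 (Finset.mem_image.2
          ⟨J, Finset.mem_powerset.2 hJ, h.symm⟩))
    · rintro ⟨⟨e, T⟩, j⟩ (hq | ⟨J, hJ, -, -, hm, hs, h⟩)
      · exact ih.2 _ hq
      · dsimp only at hm hs h ⊢
        rw [hs, h]
        exact (chosen_spec hf hV ih.1 ih.2 hm.2.1.1).1

/-- Every finite set of steps below an approximable mapping has an associate below it. -/
theorem exists_tok {f : A → Finset A → B → Prop} (hf : IsApprox A.toWitSystem B.toWitSystem f)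
    {V : Finset (Step A.toWitSystem B.toWitSystem)} (hV : ∀ p ∈ V, f p.1.1 p.1.2 p.2) :
    ∃ w : FunTok A.toWitSystem B.toWitSystem, w.V = V ∧ ∀ q ∈ w.W, f q.1.1 q.1.2 q.2 := by
  have hcon : ∀ p ∈ V, A.Con p.1.1 p.1.2 := fun p hp => hf.dom (hV p hp)
  have hWf : ∀ q ∈ ⋃ κ, assocChain f V κ, f q.1.1 q.1.2 q.2 := by
    intro q hq
    obtain ⟨κ, hκ⟩ := Set.mem_iUnion.1 hq
    exact (assocChain_spec hf hV κ).2 q hκ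
  refine ⟨⟨⋃ κ, assocChain f V κ, V, hcon, fun q hq => hf.dom (hWf q hq), reprs A,
    isReprSystem_reprs hcon, assocChain f V, ?_, rfl, rfl, fun κ =>
      ⟨stage f V (assocChain f V κ) (κ + 1), rfl, ?_, ?_⟩⟩, rfl, hWf⟩
  · exact monotone_nat_of_le_succ fun κ => Set.subset_union_left
  · intro J hJ hJc e he hm
    obtain ⟨ih1, ih2⟩ := assocChain_spec hf hV κ
    refine ⟨chosen f V (assocChain f V κ) e J, ⟨(chosen_spec hf hV ih1 ih2 hm.2.1.1).2,
      J, hJ, hJc, he, hm, rfl, rfl⟩, ?_⟩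
    rintro j ⟨-, K, hK, -, -, hm', hs, h⟩
    dsimp only at hm' hs h
    -- Two sets of steps maximal at the same e with equal supports coincide, so the stage adds only
    -- one value for the given pair.
    have hKJ : K = J := Finset.Subset.antisymm
      (maximal_subset hm' hm hs.ge (witEq_refl (by rw [← hs]; exact hm.2.1.1)))
      (maximal_subset hm hm' hs.le (witEq_refl hm.2.1.1))
    rw [h, hKJ]
  · rintro p ⟨J, hJ, hJc, he, hm, hs, h⟩
    obtain ⟨ih1, ih2⟩ := assocChain_spec hf hV κ
    refine ⟨J, hJ, hJc, he, hm, hs, ?_⟩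
    rw [h]
    exact (chosen_spec hf hV ih1 ih2 hm.2.1.1).2

end Construction

/-! ### Tokens below an approximable mapping and the axioms of the function space -/

section Ideals

open scoped Classical

variable {A B : ISW.{u}}

/-- The tokens of the function space that approximate the relation `f`. -/
def Below (f : A → Finset A → B → Prop) (x : FunTok A.toWitSystem B.toWitSystem) : Prop :=
  (∀ p ∈ x.V, f p.1.1 p.1.2 p.2) ∧
    ∀ q ∈ x.W, ∃ j, f q.1.1 q.1.2 j ∧ B.WitEq (rs q.1.1 q.1.2 x.V) j q.2

/-- The relation between `A` and `B` represented by the pair `(w, F)` of the function space. -/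
def valueRel (w : FunTok A.toWitSystem B.toWitSystem)
    (F : Finset (FunTok A.toWitSystem B.toWitSystem)) (a : A) (S : Finset A) (b : B) : Prop :=
  A.Con a S ∧ B.Ent (sel w a S) (ap a S (steps F)) b

theorem Below.mono {f g : A → Finset A → B → Prop} (h : ∀ a S b, f a S b → g a S b)
    {x : FunTok A.toWitSystem B.toWitSystem} (hx : Below f x) : Below g x :=
  ⟨fun p hp => h _ _ _ (hx.1 p hp), fun q hq => (hx.2 q hq).imp fun _ hj => ⟨h _ _ _ hj.1, hj.2⟩⟩

/-- A token below `g` is below every approximable `f ≤ g` that contains its steps. -/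
theorem Below.of_steps {f g : A → Finset A → B → Prop}
    (hf : IsApprox A.toWitSystem B.toWitSystem f) (hg : IsApprox A.toWitSystem B.toWitSystem g)
    (h : ∀ a S b, f a S b → g a S b) {x : FunTok A.toWitSystem B.toWitSystem} (hx : Below g x)
    (hV : ∀ p ∈ x.V, f p.1.1 p.1.2 p.2) : Below f x := by
  refine ⟨hV, fun q hq => ?_⟩
  obtain ⟨j, hj1, hj2⟩ := hx.2 q hq
  have hq' := hg.dom hj1
  -- The steps alone make all outputs in the spectrum values of f, so f has a value k witnessing
  -- them. Both k and j are values of g, hence equivalent relative to these outputs.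
  obtain ⟨k, hk1, hk2⟩ := hf.witness hq' (rel_of_mem_rs hf hV hq')
  exact ⟨k, hk1, (witEq_of_rel hg (h _ _ _ hk1) hj1 hk2 (con_of_witEq_left hj2)).trans hj2⟩

/-- The value of x at `(a, S)` comes from a pair of the associate whose argument carries no more
information than `(a, S)` and whose `rs` is `ap a S x.V`; the value of f given there persists at
`(a, S)`. -/
theorem Below.exists_value {f : A → Finset A → B → Prop}
    (hf : IsApprox A.toWitSystem B.toWitSystem f) {x : FunTok A.toWitSystem B.toWitSystem}
    (hx : Below f x) {a : A} {S : Finset A} (hS : A.Con a S) :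
    ∃ k, f a S k ∧ B.WitEq (ap a S x.V) k (sel x a S) := by
  obtain ⟨e, T, h1, -, h3, h4⟩ := exists_mem_assoc x hS
  obtain ⟨k, hk1, hk2⟩ := hx.2 _ h1
  refine ⟨k, rel_of_infoLe hf h3 hk1, ?_⟩
  rw [← h4]
  exact hk2

theorem rel_of_mem_ap_steps {f : A → Finset A → B → Prop}
    (hf : IsApprox A.toWitSystem B.toWitSystem f)
    {F : Finset (FunTok A.toWitSystem B.toWitSystem)} (hF : ∀ x ∈ F, Below f x)
    {a : A} {S : Finset A} (hS : A.Con a S) : ∀ c ∈ ap a S (steps F), f a S c := by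
  refine rel_of_mem_ap hf (fun p hp => ?_) hS
  obtain ⟨x, hx, hpx⟩ := mem_steps.1 hp
  exact (hF x hx).1 p hpx

/-! ### The mapping represented by a consistent pair -/

section Con

variable {w : FunTok A.toWitSystem B.toWitSystem}
  {F : Finset (FunTok A.toWitSystem B.toWitSystem)}

theorem witEq_sel_of_funCon (h : funCon A B w F) {a : A} {S : Finset A} (hS : A.Con a S) {r : B}
    (hr : B.WitEq (ap a S w.V) r (sel w a S)) : B.WitEq (ap a S (steps F)) r (sel w a S) :=
  (h a S hS).2 r hr

theorem con_sel_steps (h : funCon A B w F) {a : A} {S : Finset A} (hS : A.Con a S) :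
    B.Con (sel w a S) (ap a S (steps F)) :=
  con_of_witEq_left (witEq_sel_of_funCon h hS (witEq_refl (con_sel_ap w hS)))

/-- More information means more active outputs and a value of `w` that has the old value as a
consistent singleton; entailment survives both changes. -/
theorem valueRel_of_infoLe (h : funCon A B w F) {i a : A} {X S : Finset A} {b : B}
    (hS : A.Con a S) (hle : InfoLe A i X a S) (hb : valueRel w F i X b) : valueRel w F a S b := by
  have hc := con_sel_of_infoLe w hb.1 hS hle
  have hX := con_sel_steps h hb.1
  exact ⟨hS, B.isISW.ent_mono (B.isISW.con_wit hc hX) (con_sel_steps h hS)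
    (ap_mono (Finset.Subset.refl _) hle) (B.isISW.ent_wit hc hX hb.2)⟩

theorem isApprox_valueRel (h : funCon A B w F) :
    IsApprox A.toWitSystem B.toWitSystem (valueRel w F) := by
  have hB := B.isApprox_ent
  refine ⟨?_, ?_, ?_, ?_, ?_, ?_, ?_, ?_, ?_, ?_⟩
  · exact fun h => h.1
  · exact ⟨A.con_empty _, B.ent_bot' (con_sel_steps h (A.con_empty _))⟩
  · exact fun _ hS hs hb => valueRel_of_infoLe h hS (infoLe_of_subset hS hs) hb
  · exact fun hS hs hb => valueRel_of_infoLe h hS (infoLe_of_entSet hS hs) hb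
  · rintro a S b ⟨hS, hb⟩
    -- The interpolant has to keep all active steps of both `w` and `F` active, so it is chosen to
    -- entail their supports together with the tokens j that certify activity. Then neither the
    -- value of `w` nor the outputs of `F` change.
    choose! j hj using fun p (hp : p ∈ active a S (w.V ∪ steps F)) => (mem_active.1 hp).2
    obtain ⟨c, U, hU, hc, haU, hE⟩ := A.isApprox_ent.left
      (F := supp (dom (active a S (w.V ∪ steps F))) ∪
        (active a S (w.V ∪ steps F)).image j) hS (by
      intro d hd
      rcases Finset.mem_union.1 hd with hd | hd
      · exact entSet_supp_active d hd
      · obtain ⟨p, hp, rfl⟩ := Finset.mem_image.1 hd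
        exact (hj p hp).2.1)
    have hUa : A.Con a U := A.isISW.con_of_ent hS haU
    have hca : InfoLe A c U a U := infoLe_of_witEq (witEq_of_con (A.con_of_ent_single hc) hU)
    have hsub : ∀ V ⊆ w.V ∪ steps F, active a S V ⊆ active a U V := by
      intro V hV p hp
      have hp' : p ∈ active a S (w.V ∪ steps F) := active_mono hV (fun _ h => h) hp
      refine mem_active.2 ⟨(mem_active.1 hp).1, j p, (hj p hp').1, ?_, fun d hd => ?_⟩
      · exact hca _ (hE _ (Finset.mem_union_right _ (Finset.mem_image_of_mem _ hp')))
      · exact hca _ (hE _ (Finset.mem_union_left _ (subset_supp hp' hd)))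
    have hle : InfoLe A a U a S := infoLe_of_entSet hS haU
    have hs : sel w a U = sel w a S :=
      sel_congr w hUa hS hle (hsub _ Finset.subset_union_left)
    refine ⟨U, hUa, haU, hUa, ?_⟩
    rw [hs]
    exact B.isISW.ent_mono (B.isISW.ent_con hb) (B.isISW.con_subset
      (ap_mono (Finset.Subset.refl _) hle) (con_sel_steps h hS))
      (Finset.image_subset_image (hsub _ Finset.subset_union_right)) hb
  · exact fun hS hY hk hc hb => ⟨hS, hB.ent_right (con_sel_steps h hS) hY hk.2
      (fun c hc' => (hc c hc').2) hb⟩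
  · rintro a S b ⟨hS, hb⟩
    obtain ⟨d, V, h1, h2, h3, h4⟩ := hB.interp_right hb
    exact ⟨d, V, h1, ⟨hS, h2⟩, fun c hc => ⟨hS, h3 c hc⟩, h4⟩
  · intro a S G hS hG
    obtain ⟨e, h1, h2⟩ := hB.witness (con_sel_steps h hS) (fun c hc => (hG c hc).2)
    exact ⟨e, ⟨hS, h1⟩, h2⟩
  · intro i j X b hX hj hb
    have := witEq_of_con hj hX
    exact valueRel_of_infoLe h (con_of_witEq_right this) (infoLe_of_witEq this) hb
  · intro i j X b hX hj hb
    have := witEq_symm (witEq_of_con hj hX)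
    exact valueRel_of_infoLe h hX (infoLe_of_witEq this) hb

/-- The set in the definition of entailment, collected over the spectrum of x, is contained in `ap`
at the same argument, which gives one direction. Conversely the smaller set already entails the
outputs of the spectrum, so it entails a witness k of them; k and the value given by `Below` are
both values of `valueRel w F`, hence equivalent. -/
theorem funEnt_iff {x : FunTok A.toWitSystem B.toWitSystem} :
    funEnt A B w F x ↔ funCon A B w F ∧ Below (valueRel w F) x := by
  constructor
  · rintro ⟨h1, h2, h3⟩
    refine ⟨h1, fun p hp => ⟨x.con p hp, h2 p hp⟩, fun q hq => ?_⟩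
    obtain ⟨k, hk1, hk2, -⟩ := h3 q hq
    have hq' := x.assoc.1 q hq
    refine ⟨k, ⟨hq', B.isISW.ent_mono (B.isISW.ent_con hk2) (con_sel_steps h1 hq') ?_ hk2⟩,
      witEq_symm hk1⟩
    refine Finset.biUnion_subset.2 fun y hy => ?_
    obtain ⟨p, hp, rfl⟩ := mem_dom.1 hy
    exact ap_mono (Finset.Subset.refl _) (infoLe_of_mem_sp hq' hp)
  · rintro ⟨h1, h2, h3⟩
    refine ⟨h1, fun p hp => (h2 p hp).2, fun q hq => ?_⟩
    have hq' := x.assoc.1 q hq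
    have hsub : ((ds q.1.1 q.1.2 x.V).biUnion fun y => ap y.1 y.2 (steps F)) ⊆
        ap q.1.1 q.1.2 (steps F) := by
      refine Finset.biUnion_subset.2 fun y hy => ?_
      obtain ⟨p, hp, rfl⟩ := mem_dom.1 hy
      exact ap_mono (Finset.Subset.refl _) (infoLe_of_mem_sp hq' hp)
    have hc := B.isISW.con_subset hsub (con_sel_steps h1 hq')
    have hE : B.EntSet (sel w q.1.1 q.1.2)
        ((ds q.1.1 q.1.2 x.V).biUnion fun y => ap y.1 y.2 (steps F)) (rs q.1.1 q.1.2 x.V) := by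
      intro c hc'
      obtain ⟨p, hp, rfl⟩ := mem_rs.1 hc'
      obtain ⟨hp1, hp2⟩ := h2 p (Finset.mem_filter.1 hp).1
      have hs := con_sel_of_infoLe w hp1 hq' (infoLe_of_mem_sp hq' hp)
      have hX := con_sel_steps h1 hp1
      exact B.isISW.ent_mono (B.isISW.con_wit hs hX) hc
        (Finset.subset_biUnion_of_mem (fun y : Pt A.toWitSystem => ap y.1 y.2 (steps F))
          (mem_dom.2 ⟨p, hp, rfl⟩)) (B.isISW.ent_wit hs hX hp2)
    obtain ⟨k, hk1, hk2⟩ := B.isISW.ent_witness hc hE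
    obtain ⟨j, hj1, hj2⟩ := h3 q hq
    refine ⟨k, ?_, hk1, hE⟩
    exact (witEq_symm hj2).trans (witEq_of_rel (isApprox_valueRel h1) hj1
      ⟨hq', B.isISW.ent_mono hc (con_sel_steps h1 hq') hsub hk1⟩ (con_of_witEq_left hj2) hk2)

theorem valueRel_le_of_steps {G : Finset (FunTok A.toWitSystem B.toWitSystem)}
    (h : funCon A B w F) (hG : ∀ x ∈ G, Below (valueRel w F) x) {a : A} {S : Finset A} {b : B}
    (hb : valueRel w G a S b) : valueRel w F a S b :=
  ⟨hb.1, B.isISW.ent_trans (con_sel_steps h hb.1)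
    (fun c hc => (rel_of_mem_ap_steps (isApprox_valueRel h) hG hb.1 c hc).2) hb.2⟩

theorem funCon_subset {G : Finset (FunTok A.toWitSystem B.toWitSystem)} (hs : G ⊆ F)
    (h : funCon A B w F) : funCon A B w G :=
  fun a S hS => ⟨fun g hg => (h a S hS).1 g (hs hg), fun r hr =>
    witEq_mono (ap_mono (steps_mono hs) fun _ h => h) ((h a S hS).2 r hr)⟩

theorem valueRel_mono {G : Finset (FunTok A.toWitSystem B.toWitSystem)} (hs : F ⊆ G)
    (h : funCon A B w G) {a : A} {S : Finset A} {b : B}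
    (hb : valueRel w F a S b) : valueRel w G a S b :=
  ⟨hb.1, B.isISW.ent_mono (B.isISW.ent_con hb.2) (con_sel_steps h hb.1)
    (ap_mono (steps_mono hs) fun _ h => h) hb.2⟩

theorem funCon_self (w : FunTok A.toWitSystem B.toWitSystem) : funCon A B w {w} := by
  intro a S hS
  refine ⟨fun g hg => ?_, fun r hr => ?_⟩
  · rw [Finset.mem_singleton.1 hg]
    exact ⟨_, witEq_refl (con_sel_ap w hS), B.isISW.con_self _⟩
  · rw [steps_singleton]
    exact hr

theorem funCon_empty (w : FunTok A.toWitSystem B.toWitSystem) : funCon A B w ∅ :=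
  funCon_subset (Finset.empty_subset _) (funCon_self w)

/-- For tokens below `valueRel w F`, values can be replaced by equivalent tokens that `w` and `F`
entail, and entailed tokens are consistent. The active outputs of `G` are entailed as well, so
equivalence relative to those of `F` passes to them. -/
theorem funCon_of_below {G : Finset (FunTok A.toWitSystem B.toWitSystem)} (h : funCon A B w F)
    (hG : ∀ x ∈ G, Below (valueRel w F) x) : funCon A B w G := by
  intro a S hS
  refine ⟨fun g hg => ?_, fun r hr => ?_⟩
  · obtain ⟨k, hk1, hk2⟩ := (hG g hg).exists_value (isApprox_valueRel h) hS
    exact ⟨k, witEq_symm hk2, B.con_of_ent_single hk1.2⟩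
  · have := witEq_sel_of_funCon h hS hr
    exact witEq_symm (witEq_of_entSet (witEq_symm this) fun c hc =>
      (rel_of_mem_ap_steps (isApprox_valueRel h) hG hS c hc).2)

variable {v : FunTok A.toWitSystem B.toWitSystem}

theorem witEq_sel_sel (hv : funCon A B w {v}) {a : A} {S : Finset A}
    (hS : A.Con a S) : ∃ k, B.WitEq (ap a S v.V) k (sel v a S) ∧ B.Con (sel w a S) {k} ∧
      B.WitEq (ap a S v.V) (sel w a S) (sel v a S) := by
  obtain ⟨k, hk1, hk2⟩ := (hv a S hS).1 v (Finset.mem_singleton_self v)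
  exact ⟨k, witEq_symm hk1, hk2,
    (witEq_symm (witEq_of_con hk2 (con_of_witEq_right hk1))).trans (witEq_symm hk1)⟩

theorem witEq_sel_steps (hv : funCon A B w {v}) (h : funCon A B v F) {a : A} {S : Finset A}
    (hS : A.Con a S) : B.WitEq (ap a S (steps F)) (sel w a S) (sel v a S) := by
  obtain ⟨k, -, -, hk⟩ := witEq_sel_sel hv hS
  exact witEq_sel_of_funCon h hS hk

theorem funCon_trans (hv : funCon A B w {v}) (h : funCon A B v F) : funCon A B w F := by
  intro a S hS
  obtain ⟨k, hk1, hk2, hk3⟩ := witEq_sel_sel hv hS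
  refine ⟨fun g hg => ?_, fun r hr => ?_⟩
  · obtain ⟨l, hl1, hl2⟩ := (h a S hS).1 g hg
    -- The token k that serves for v serves for g too: the value of g is equivalent to l, l to the
    -- value of v, and that value to k.
    refine ⟨k, (hl1.trans (witEq_of_con hl2 (con_of_witEq_right hl1))).trans ?_, hk2⟩
    exact witEq_symm (witEq_mono (ap_mono (subset_steps hg) fun _ h => h)
      (witEq_sel_of_funCon h hS hk1))
  · have h1 := witEq_sel_of_funCon hv hS hr
    rw [steps_singleton] at h1
    exact (witEq_sel_of_funCon h hS (h1.trans hk3)).trans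
      (witEq_symm (witEq_sel_of_funCon h hS hk3))

/-- When `w` witnesses v, their values are equivalent relative to the active outputs of `F` and so
entail the same tokens. This is the invariance of entailment under change of witness. -/
theorem valueRel_eq_of_funCon (hv : funCon A B w {v}) (h : funCon A B v F) :
    (valueRel w F : A → Finset A → B → Prop) = valueRel v F := by
  funext a S b
  exact propext ⟨fun hb => ⟨hb.1, ent_of_witEq (witEq_sel_steps hv h hb.1) hb.2⟩,
    fun hb => ⟨hb.1, ent_of_witEq (witEq_symm (witEq_sel_steps hv h hb.1)) hb.2⟩⟩

end Con

/-- The relation represented by tokens below `f` is contained in `f`. -/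
theorem rel_of_valueRel {f : A → Finset A → B → Prop}
    (hf : IsApprox A.toWitSystem B.toWitSystem f) {w : FunTok A.toWitSystem B.toWitSystem}
    {F : Finset (FunTok A.toWitSystem B.toWitSystem)} (h : funCon A B w F) (hw : Below f w)
    (hF : ∀ x ∈ F, Below f x) {a : A} {S : Finset A} {b : B} (hb : valueRel w F a S b) :
    f a S b := by
  obtain ⟨k, hk1, hk2⟩ := hw.exists_value hf hb.1
  -- The second clause of consistency is used here: equivalence relative to the outputs of `w`
  -- becomes equivalence relative to those of `F`.
  have hk := witEq_sel_of_funCon h hb.1 hk2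
  exact hf.ent_right hb.1 (con_of_witEq_left hk) hk1 (rel_of_mem_ap_steps hf hF hb.1)
    (ent_of_witEq (witEq_symm hk) hb.2)

/-- Every step of J, taken as a one-element K, puts its output among the tokens to be witnessed at
J, and by maximality J is the whole spectrum. This makes each second component equivalent to itself
relative to `rs`. -/
theorem con_rs_of_mem_assoc (w : FunTok A.toWitSystem B.toWitSystem)
    {q : Step A.toWitSystem B.toWitSystem} (hq : q ∈ w.W) :
    B.Con q.2 (rs q.1.1 q.1.2 w.V) := by
  obtain ⟨-, R, -, chain, -, hW, h0, hstep⟩ := w.assoc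
  rw [hW] at hq
  obtain ⟨κ, hκ⟩ := Set.mem_iUnion.1 hq
  clear hq
  induction κ with
  | zero =>
    rw [h0] at hκ
    split_ifs at hκ with hmax
    · rw [Set.mem_singleton_iff.1 hκ]
      have : sp A.bot ∅ w.V = ∅ := sp_eq_of_maximal hmax
      dsimp only
      rw [rs, this]
      exact B.con_empty _
    · exact hκ.elim
  | succ κ ih =>
    obtain ⟨W', h1, -, h2⟩ := hstep κ
    rw [h1] at hκ
    rcases hκ with hκ | hκ
    · exact ih hκ
    obtain ⟨J, hJ, -, -, hm, hs, F, hF, hFc⟩ := h2 q hκ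
    refine B.isISW.con_subset (fun c hc => ?_) hFc
    rw [hs, rs, sp_eq_of_maximal hm] at hc
    obtain ⟨p, hp, rfl⟩ := Finset.mem_image.1 hc
    have hd : supp (dom ({p} : Finset (Step A.toWitSystem B.toWitSystem))) = p.1.2 := by
      rw [dom, Finset.image_singleton, supp_singleton]
    rw [← Finset.mem_coe, hF]
    refine ⟨p.1.1, {p}, Finset.singleton_subset_iff.2 (hJ hp), ?_, ?_,
      Or.inl ⟨Finset.card_singleton p, ?_⟩⟩
    · rw [hd]; exact subset_supp hp
    · rw [hd]; exact witEq_symm (hm.2.1.2 _ (mem_dom.2 ⟨p, hp, rfl⟩))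
    · rw [hd]; exact hJ hp

theorem exists_below {f : A → Finset A → B → Prop}
    (hf : IsApprox A.toWitSystem B.toWitSystem f)
    {V : Finset (Step A.toWitSystem B.toWitSystem)} (hV : ∀ p ∈ V, f p.1.1 p.1.2 p.2) :
    ∃ w : FunTok A.toWitSystem B.toWitSystem, w.V = V ∧ Below f w := by
  obtain ⟨w, hwV, hwW⟩ := exists_tok hf hV
  exact ⟨w, hwV, by rwa [hwV], fun q hq => ⟨q.2, hwW q hq, witEq_refl (con_rs_of_mem_assoc w hq)⟩⟩

/-- Finitely many tokens below `f` have a witness below `f`. -/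
theorem exists_witness_below {f : A → Finset A → B → Prop}
    (hf : IsApprox A.toWitSystem B.toWitSystem f)
    {F : Finset (FunTok A.toWitSystem B.toWitSystem)} (hF : ∀ x ∈ F, Below f x) :
    ∃ w, Below f w ∧ funCon A B w F := by
  -- With exactly the steps of `F`, the second clause of consistency becomes trivial.
  obtain ⟨w, hwV, hw⟩ := exists_below hf (V := steps F) (by
    intro p hp
    obtain ⟨x, hx, hpx⟩ := mem_steps.1 hp
    exact (hF x hx).1 p hpx)
  refine ⟨w, hw, fun a S hS => ⟨fun g hg => ?_, fun r hr => by rwa [← hwV]⟩⟩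
  obtain ⟨k, hk1, hk2⟩ := hw.exists_value hf hS
  obtain ⟨l, hl1, hl2⟩ := (hF g hg).exists_value hf hS
  have hsub : ap a S g.V ⊆ ap a S w.V :=
    ap_mono (by rw [hwV]; exact subset_steps hg) fun _ h => h
  have hk := witEq_mono hsub hk2
  exact ⟨sel w a S, (witEq_symm hl2).trans
    ((witEq_of_rel hf hl1 hk1 (con_of_witEq_left hl2) (con_of_witEq_left hk)).trans hk),
    B.isISW.con_self _⟩

/-- Finitely many pairs below an approximable mapping are represented by one token. -/
theorem exists_tok_valueRel {f : A → Finset A → B → Prop}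
    (hf : IsApprox A.toWitSystem B.toWitSystem f)
    {V : Finset (Step A.toWitSystem B.toWitSystem)} (hV : ∀ p ∈ V, f p.1.1 p.1.2 p.2) :
    ∃ z, Below f z ∧ ∀ w, funCon A B w {z} → ∀ p ∈ V, valueRel w {z} p.1.1 p.1.2 p.2 := by
  have key : ∀ p ∈ V, ∃ d C c U, B.Ent d C p.2 ∧ A.Con c U ∧ A.Ent p.1.1 p.1.2 c ∧
      A.EntSet p.1.1 p.1.2 U ∧ ∀ b ∈ insert d C, f c U b := by
    intro p hp
    obtain ⟨d, C, -, h2, h3, h4⟩ := hf.interp_right (hV p hp)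
    obtain ⟨c, U, g1, g2, g3, g4⟩ := hf.left (F := insert d C) (hf.dom h2)
      (Finset.forall_mem_insert _ _ _ |>.2 ⟨h2, h3⟩)
    exact ⟨d, C, c, U, h4, g1, g2, g3, g4⟩
  choose! d C c U h1 h2 h3 h4 h5 using key
  obtain ⟨z, hzV, hz⟩ := exists_below hf
    (V := V.biUnion fun p => (insert (d p) (C p)).image fun b => ((c p, U p), b)) (by
      intro q hq
      obtain ⟨p, hp, hq⟩ := Finset.mem_biUnion.1 hq
      obtain ⟨b, hb, rfl⟩ := Finset.mem_image.1 hq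
      exact h5 p hp b hb)
  refine ⟨z, hz, fun w hw p hp => ?_⟩
  have hpc := A.isISW.ent_con (h3 p hp)
  have hsub : insert (d p) (C p) ⊆ ap p.1.1 p.1.2 (steps {z}) := by
    intro b hb
    rw [steps_singleton, mem_ap]
    refine ⟨((c p, U p), b), mem_active.2 ⟨?_, c p, witEq_refl (h2 p hp), h3 p hp, h4 p hp⟩, rfl⟩
    rw [hzV]
    exact Finset.mem_biUnion.2 ⟨p, hp, Finset.mem_image.2 ⟨b, hb, rfl⟩⟩
  -- All these outputs are active at the argument of p, so any witness of z has a value there at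
  -- which `d p` and `C p` are consistent, and entailment from `(d p, C p)` transfers to it.
  have hcon := con_sel_steps hw hpc
  have hd : B.Con (sel w p.1.1 p.1.2) {d p} := B.isISW.con_subset
    (Finset.singleton_subset_iff.2 (hsub (Finset.mem_insert_self _ _))) hcon
  have hC := B.isISW.ent_con (h1 p hp)
  exact ⟨hpc, B.isISW.ent_mono (B.isISW.con_wit hd hC) hcon
    ((Finset.subset_insert _ _).trans hsub) (B.isISW.ent_wit hd hC (h1 p hp))⟩

/-- Interpolation for tokens below an approximable mapping. -/
theorem exists_funEnt_below {f : A → Finset A → B → Prop}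
    (hf : IsApprox A.toWitSystem B.toWitSystem f) {x : FunTok A.toWitSystem B.toWitSystem}
    (hx : Below f x) : ∃ w z, Below f w ∧ Below f z ∧ funEnt A B w {z} x := by
  obtain ⟨z, hz, hzx⟩ := exists_tok_valueRel hf hx.1
  have hz' : ∀ y ∈ ({z} : Finset (FunTok A.toWitSystem B.toWitSystem)), Below f y := by simpa
  obtain ⟨w, hw, hwz⟩ := exists_witness_below hf hz'
  exact ⟨w, z, hw, hz, funEnt_iff.2 ⟨hwz, hx.of_steps (isApprox_valueRel hwz) hf
    (fun a S b => rel_of_valueRel hf hwz hw hz') (hzx w hwz)⟩⟩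

theorem below_botTok {f : A → Finset A → B → Prop}
    (hf : IsApprox A.toWitSystem B.toWitSystem f) : Below f (botTok A B) := by
  refine ⟨fun p hp => absurd hp (Finset.notMem_empty p), fun q hq => ?_⟩
  rw [Set.mem_singleton_iff.1 hq]
  exact ⟨B.bot, hf.bot, witEq_refl (B.con_empty _)⟩

variable (A B) in
-- Through `funEnt_iff` the entailment axioms concern tokens below `valueRel w X`; the axioms about
-- changing the witness are transitivity of consistency and equality of the represented mappings.
theorem funSpace_isISW : (funSpaceData A B).IsISW := by
  refine ⟨?_, ?_, ?_, ?_, ?_, ?_, ?_, ?_, ?_, ?_, ?_, ?_⟩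
  · exact fun h => h.1
  · exact funCon_self
  · exact funCon_subset
  · exact fun w => funEnt_iff.2
      ⟨funCon_empty w, below_botTok (isApprox_valueRel (funCon_empty w))⟩
  · exact fun h hY => funCon_of_below h fun y hy => (funEnt_iff.1 (hY y hy)).2
  · exact fun hX hY hs h => funEnt_iff.2
      ⟨hY, (funEnt_iff.1 h).2.mono fun _ _ _ => valueRel_mono hs hY⟩
  · exact fun hX hY h => funEnt_iff.2 ⟨hX, (funEnt_iff.1 h).2.mono fun _ _ _ =>
      valueRel_le_of_steps hX fun y hy => (funEnt_iff.1 (hY y hy)).2⟩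
  · intro w X x h
    obtain ⟨hX, hx⟩ := funEnt_iff.1 h
    have hf := isApprox_valueRel hX
    obtain ⟨z, hz, hzx⟩ := exists_tok_valueRel hf hx.1
    have hz' : ∀ y ∈ ({z} : Finset (FunTok A.toWitSystem B.toWitSystem)),
        Below (valueRel w X) y := by simpa
    have hwz := funCon_of_below hX hz'
    exact ⟨{z}, hwz, fun y hy => funEnt_iff.2 ⟨hX, hz' y hy⟩, funEnt_iff.2
      ⟨hwz, hx.of_steps (isApprox_valueRel hwz) hf (fun _ _ _ => valueRel_le_of_steps hX hz')
        (hzx w hwz)⟩⟩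
  · intro w X Y hX hY
    obtain ⟨e, he1, he2⟩ := exists_witness_below (isApprox_valueRel hX) (F := Y)
      fun y hy => (funEnt_iff.1 (hY y hy)).2
    exact ⟨e, funEnt_iff.2 ⟨hX, he1⟩, he2⟩
  · exact fun h hX => funCon_trans h hX
  · intro v w X x h hX hx
    refine funEnt_iff.2 ⟨funCon_trans h hX, ?_⟩
    rw [valueRel_eq_of_funCon h hX]
    exact (funEnt_iff.1 hx).2
  · intro v w X x h hX hx
    refine funEnt_iff.2 ⟨hX, ?_⟩
    rw [← valueRel_eq_of_funCon h hX]
    exact (funEnt_iff.1 hx).2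

end Ideals

/-! ### Fixing one argument, and currying -/

section Boxes

open scoped Classical

variable {A B C : ISW.{u}}

theorem rel_bot {H : A → Finset A → B → Prop} (hH : IsApprox A.toWitSystem B.toWitSystem H)
    {i : A} {X : Finset A} (hX : A.Con i X) : H i X B.bot :=
  hH.strong (A.ent_bot' hX) (Y := ∅) (fun _ ha => absurd ha (Finset.notMem_empty _)) hH.bot

theorem con_box {p : A.prod B} {X : Finset A} {Y : Finset B} (hX : A.Con p.1 X)
    (hY : B.Con p.2 Y) : (A.prod B).Con p (box A.toWitSystem B.toWitSystem X Y) := by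
  refine ⟨?_, ?_⟩
  · rw [image_fst_box]; exact A.con_pad hX
  · rw [image_snd_box]; exact B.con_pad hY

theorem ent_box {p q : A.prod B} {X : Finset A} {Y : Finset B} (hX : A.Con p.1 X)
    (hY : B.Con p.2 Y) : (A.prod B).Ent p (box A.toWitSystem B.toWitSystem X Y) q ↔
      A.Ent p.1 X q.1 ∧ B.Ent p.2 Y q.2 := by
  change A.Ent _ _ _ ∧ B.Ent _ _ _ ↔ _
  rw [image_fst_box, image_snd_box, A.ent_pad hX, B.ent_pad hY]

theorem forall_mem_box {P : A → Prop} {Q : B → Prop} {X : Finset A} {Y : Finset B}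
    (hP : P A.bot) (hQ : Q B.bot) (hX : ∀ a ∈ X, P a) (hY : ∀ b ∈ Y, Q b) :
    ∀ q ∈ box A.toWitSystem B.toWitSystem X Y, P q.1 ∧ Q q.2 := by
  intro q hq
  obtain ⟨h1, h2⟩ := Finset.mem_product.1 hq
  refine ⟨?_, ?_⟩
  · split_ifs at h1
    · rw [Finset.mem_singleton.1 h1]; exact hP
    · exact hX _ h1
  · split_ifs at h2
    · rw [Finset.mem_singleton.1 h2]; exact hQ
    · exact hY _ h2

theorem subset_pad {X : Finset A} : X ⊆ if X = ∅ then {A.bot} else X := by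
  split_ifs with h
  · rw [h]; exact Finset.empty_subset _
  · exact Finset.Subset.refl _

theorem infoLe_pad {i : A} {X : Finset A} (hX : A.Con i X) :
    InfoLe A i (if X = ∅ then {A.bot} else X) i X :=
  fun _ => (A.ent_pad hX).1

theorem infoLe_box {p q : A.prod B} {X X' : Finset A} {Y Y' : Finset B} (hX : A.Con p.1 X)
    (hY : B.Con p.2 Y) (hX' : A.Con q.1 X') (hY' : B.Con q.2 Y') (h : InfoLe A p.1 X q.1 X')
    (h' : InfoLe B p.2 Y q.2 Y') :
    InfoLe (A.prod B) p (box A.toWitSystem B.toWitSystem X Y) q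
      (box A.toWitSystem B.toWitSystem X' Y') :=
  fun r hr => (ent_box hX' hY').2
    ⟨h _ ((ent_box (q := r) hX hY).1 hr).1, h' _ ((ent_box (q := r) hX hY).1 hr).2⟩

/-- Fixing the first argument of a relation on a product. -/
def fixFst (H : C.prod A → Finset (C.prod A) → B → Prop) (c : C) (S : Finset C) :
    A → Finset A → B → Prop :=
  fun i X b => H (c, i) (box C.toWitSystem A.toWitSystem S X) b

section FixFst

variable {H : C.prod A → Finset (C.prod A) → B → Prop}
  (hH : IsApprox (C.prod A).toWitSystem B.toWitSystem H)

include hH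

theorem con_of_fixFst {c : C} {S : Finset C} {i : A} {X : Finset A} {b : B}
    (h : fixFst H c S i X b) : A.Con i X := by
  have := (hH.dom h).2
  rw [image_snd_box] at this
  exact A.isISW.con_subset subset_pad this

theorem fixFst_mono {c d : C} {S T : Finset C} (hS : C.Con c S) (hT : C.Con d T)
    (h : InfoLe C c S d T) {i j : A} {X Y : Finset A} (hY : A.Con j Y) (h' : InfoLe A i X j Y)
    {b : B} (hb : fixFst H c S i X b) : fixFst H d T j Y b :=
  rel_of_infoLe hH (infoLe_box hS (con_of_fixFst hH hb) hT hY h h') hb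

theorem fixFst_interp {c : C} {S : Finset C} {i : A} {X : Finset A} {b : B} (hS : C.Con c S)
    (h : fixFst H c S i X b) : ∃ T Y, C.EntSet c S T ∧ A.EntSet i X Y ∧ fixFst H c T i Y b := by
  have hX := con_of_fixFst hH h
  obtain ⟨U, -, hU, h1⟩ := hH.interp_left h
  -- The first interpolant need not be a box. A second one, entailed by it, is also entailed by the
  -- box of its projections, which suffices.
  obtain ⟨T, -, hT, h2⟩ := hH.interp_left h1
  have hfst : C.EntSet c S (U.image Prod.fst) := by
    intro d hd
    obtain ⟨q, hq, rfl⟩ := Finset.mem_image.1 hd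
    exact ((ent_box hS hX).1 (hU q hq)).1
  have hsnd : A.EntSet i X (U.image Prod.snd) := by
    intro d hd
    obtain ⟨q, hq, rfl⟩ := Finset.mem_image.1 hd
    exact ((ent_box hS hX).1 (hU q hq)).2
  have hc := C.isISW.con_of_ent hS hfst
  have hi := A.isISW.con_of_ent hX hsnd
  exact ⟨_, _, hfst, hsnd, hH.ent_left (con_box hc hi)
    (fun q hq => (ent_box (p := (c, i)) hc hi).2 (hT q hq)) h2⟩

theorem isApprox_fixFst {c : C} {S : Finset C} (hS : C.Con c S) :
    IsApprox A.toWitSystem B.toWitSystem (fixFst H c S) := by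
  refine ⟨con_of_fixFst hH, ?_, ?_, ?_, ?_, ?_, ?_, ?_, ?_, ?_⟩
  · exact rel_bot hH (con_box hS (A.con_empty _))
  · exact fun _ hX hs => fixFst_mono hH hS hS (fun _ h => h) hX (infoLe_of_subset hX hs)
  · exact fun hX hs => fixFst_mono hH hS hS (fun _ h => h) hX (infoLe_of_entSet hX hs)
  · intro i X b h
    obtain ⟨T, Y, hT, hY, h'⟩ := fixFst_interp hH hS h
    have hi := con_of_fixFst hH h'
    exact ⟨Y, hi, hY, fixFst_mono hH (C.isISW.con_of_ent hS hT) hS (infoLe_of_entSet hS hT) hi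
      (fun _ h => h) h'⟩
  · exact fun hX hY => hH.ent_right (con_box hS hX) hY
  · exact hH.interp_right
  · exact fun hX => hH.witness (con_box hS hX)
  · intro i j X b hX hj
    have := witEq_of_con hj hX
    exact fixFst_mono hH hS hS (fun _ h => h) (con_of_witEq_right this) (infoLe_of_witEq this)
  · intro i j X b hX hj
    have := witEq_symm (witEq_of_con hj hX)
    exact fixFst_mono hH hS hS (fun _ h => h) hX (infoLe_of_witEq this)

/-- The currying of an approximable mapping is approximable. -/
theorem isApprox_lamRel : IsApprox C.toWitSystem (funSpaceData A B) (lamRel H) := by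
  have le : ∀ {c d S T x}, C.Con d T → InfoLe C c S d T → lamRel H c S x → lamRel H d T x :=
    fun hT h hx => ⟨hT, Below.mono (f := fixFst H _ _) (g := fixFst H _ _)
      (fun _ _ _ hb => fixFst_mono hH hx.1 hT h (con_of_fixFst hH hb) (fun _ h => h) hb) hx.2⟩
  refine ⟨fun h => h.1, ?_, ?_, ?_, ?_, ?_, ?_, ?_, ?_, ?_⟩
  · exact ⟨C.con_empty _, below_botTok (isApprox_fixFst hH (C.con_empty _))⟩
  · exact fun _ hT hs => le hT (infoLe_of_subset hT hs)
  · exact fun hT hs => le hT (infoLe_of_entSet hT hs)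
  · rintro c S x ⟨hS, hx⟩
    -- Only the finitely many steps of x need an interpolated first argument; its possibly infinite
    -- associate follows by `Below.of_steps`.
    choose! T Y hT hY hTY using fun p (hp : p ∈ x.V) => fixFst_interp hH hS (hx.1 p hp)
    have hE : C.EntSet c S (x.V.biUnion T) := by
      intro d hd
      obtain ⟨p, hp, hd⟩ := Finset.mem_biUnion.1 hd
      exact hT p hp d hd
    have hU := C.isISW.con_of_ent hS hE
    refine ⟨_, hU, hE, hU, Below.of_steps (f := fixFst H _ _) (g := fixFst H _ _)
      (isApprox_fixFst hH hU) (isApprox_fixFst hH hS) (fun _ _ _ hb => fixFst_mono hH hU hS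
        (infoLe_of_entSet hS hE) (con_of_fixFst hH hb) (fun _ h => h) hb) hx fun p hp => ?_⟩
    have hX := x.con p hp
    exact fixFst_mono hH (C.isISW.con_of_ent hS (hT p hp)) hU
      (infoLe_of_subset hU (Finset.subset_biUnion_of_mem T hp)) hX
      (infoLe_of_entSet hX (hY p hp)) (hTY p hp)
  · rintro c S w F x hS hF hw hx h
    have hf := isApprox_fixFst hH hS
    exact ⟨hS, (funEnt_iff.1 h).2.mono fun _ _ _ =>
      rel_of_valueRel hf hF hw.2 fun y hy => (hx y hy).2⟩
  · rintro c S x ⟨hS, hx⟩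
    obtain ⟨w, z, hw, hz, h⟩ := exists_funEnt_below (isApprox_fixFst hH hS) hx
    refine ⟨w, {z}, h.1, ⟨hS, hw⟩, fun y hy => ?_, h⟩
    rw [Finset.mem_singleton.1 hy]
    exact ⟨hS, hz⟩
  · intro c S F hS hF
    obtain ⟨w, h1, h2⟩ := exists_witness_below (isApprox_fixFst hH hS) fun x hx => (hF x hx).2
    exact ⟨w, ⟨hS, h1⟩, h2⟩
  · intro c d S x hS hd
    have := witEq_of_con hd hS
    exact le (con_of_witEq_right this) (infoLe_of_witEq this)
  · intro c d S x hS hd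
    have := witEq_symm (witEq_of_con hd hS)
    exact le hS (infoLe_of_witEq this)

end FixFst

end Boxes

/-! ### Evaluation and the universal property -/

section Exponent

open scoped Classical

/-- The function space as an information system with witnesses. -/
abbrev funSpace (A B : ISW.{u}) : ISW.{u} := ⟨funSpaceData A B, funSpace_isISW A B⟩

variable {A B C : ISW.{u}}

theorem evRel_iff {p : (funSpace A B).prod A} {Z : Finset ((funSpace A B).prod A)} {b : B} :
    evRel A B p Z b ↔ ((funSpace A B).prod A).Con p Z ∧
      valueRel p.1 (Z.image Prod.fst) p.2 (Z.image Prod.snd) b :=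
  ⟨fun h => ⟨h.1, h.1.2, h.2⟩, fun h => ⟨h.1, h.2.2⟩⟩

theorem evRel_box {w : funSpace A B} {F : Finset (funSpace A B)} {a : A} {S : Finset A} {b : B}
    (hF : (funSpace A B).Con w F) (h : valueRel w F a S b) :
    evRel A B (w, a) (box (funSpaceData A B) A.toWitSystem F S) b := by
  have hc := con_box (A := funSpace A B) (B := A) (p := (w, a)) hF h.1
  exact evRel_iff.2 ⟨hc, valueRel_of_infoLe hc.1 hc.2
    (infoLe_of_subset hc.2 (subset_pad.trans (image_snd_box _ _ F S).ge))
    (valueRel_mono ((subset_pad (A := funSpace A B)).trans (image_fst_box _ _ F S).ge) hc.1 h)⟩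

variable (A B) in
-- By `evRel_iff` evaluation is `valueRel` at the projections. Changes of the argument in `A` are
-- covered by approximability of `valueRel`, changes of the set of function tokens by its
-- monotonicity, and changes of the function witness by `valueRel_eq_of_funCon`.
theorem isApprox_evRel :
    IsApprox ((funSpace A B).prod A).toWitSystem B.toWitSystem (evRel A B) := by
  have hfst : ∀ {p Z Z'}, ((funSpace A B).prod A).EntSet p Z Z' →
      ∀ x ∈ Z'.image Prod.fst, Below (valueRel p.1 (Z.image Prod.fst)) x := by
    intro p Z Z' h x hx
    obtain ⟨q, hq, rfl⟩ := Finset.mem_image.1 hx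
    exact (funEnt_iff.1 (h q hq).1).2
  have hsnd : ∀ {p Z Z'}, ((funSpace A B).prod A).EntSet p Z Z' →
      A.EntSet p.2 (Z.image Prod.snd) (Z'.image Prod.snd) := by
    intro p Z Z' h a ha
    obtain ⟨q, hq, rfl⟩ := Finset.mem_image.1 ha
    exact (h q hq).2
  refine ⟨fun h => h.1, ?_, ?_, ?_, ?_, ?_, ?_, ?_, ?_, ?_⟩
  · exact evRel_iff.2 ⟨ISW.con_empty _ _, (isApprox_valueRel (funCon_empty _)).bot⟩
  · intro p Z Z' b hZ hZ' hs h
    exact evRel_iff.2 ⟨hZ', valueRel_of_infoLe hZ'.1 hZ'.2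
      (infoLe_of_subset hZ'.2 (Finset.image_subset_image hs))
      (valueRel_mono (Finset.image_subset_image hs) hZ'.1 (evRel_iff.1 h).2)⟩
  · intro p Z Z' b hZ hE h
    exact evRel_iff.2 ⟨hZ, valueRel_of_infoLe hZ.1 hZ.2 (infoLe_of_entSet hZ.2 (hsnd hE))
      (valueRel_le_of_steps hZ.1 (hfst hE) (evRel_iff.1 h).2)⟩
  · rintro ⟨w, a⟩ Z b h
    obtain ⟨hZ, hb⟩ := evRel_iff.1 h
    -- The two factors are interpolated in turn: first the set of function tokens is replaced by one
    -- entailed token z, then the argument set by S.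
    obtain ⟨z, hz, hzb⟩ := exists_tok_valueRel (isApprox_valueRel hZ.1)
      (V := {((a, Z.image Prod.snd), b)}) (by
        intro p hp
        rw [Finset.mem_singleton.1 hp]
        exact hb)
    have hz' : ∀ y ∈ ({z} : Finset (funSpace A B)), Below (valueRel w (Z.image Prod.fst)) y := by
      simpa
    have hwz := funCon_of_below hZ.1 hz'
    obtain ⟨S, hS, haS, hSb⟩ := (isApprox_valueRel hwz).interp_left
      (hzb w hwz _ (Finset.mem_singleton_self _))
    have hbox := evRel_box hwz hSb
    refine ⟨_, hbox.1, ?_, hbox⟩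
    exact forall_mem_box (A := funSpace A B) (B := A)
      ((funSpace A B).ent_bot' hZ.1) (A.ent_bot' hZ.2)
      (fun y hy => funEnt_iff.2 ⟨hZ.1, hz' y hy⟩) haS
  · intro p Z k Y b hZ hY hk hc hb
    exact evRel_iff.2 ⟨hZ, (isApprox_valueRel hZ.1).ent_right hZ.2 hY (evRel_iff.1 hk).2
      (fun c h => (evRel_iff.1 (hc c h)).2) hb⟩
  · intro p Z b h
    obtain ⟨hZ, hb⟩ := evRel_iff.1 h
    obtain ⟨d, V, h1, h2, h3, h4⟩ := (isApprox_valueRel hZ.1).interp_right hb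
    exact ⟨d, V, h1, evRel_iff.2 ⟨hZ, h2⟩, fun c hc => evRel_iff.2 ⟨hZ, h3 c hc⟩, h4⟩
  · intro p Z F hZ hF
    obtain ⟨e, h1, h2⟩ := (isApprox_valueRel hZ.1).witness hZ.2
      (fun c hc => (evRel_iff.1 (hF c hc)).2)
    exact ⟨e, evRel_iff.2 ⟨hZ, h1⟩, h2⟩
  · rintro p q Z b hZ hq h
    have hqZ := ((funSpace A B).prod A).isISW.con_wit hq hZ
    obtain ⟨h1, h2⟩ := hq
    rw [Finset.image_singleton] at h1 h2
    refine evRel_iff.2 ⟨hqZ, ?_⟩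
    rw [valueRel_eq_of_funCon h1 hZ.1]
    exact (isApprox_valueRel hZ.1).wit hZ.2 h2 (evRel_iff.1 h).2
  · rintro p q Z b hZ hq h
    obtain ⟨h1, h2⟩ := hq
    rw [Finset.image_singleton] at h1 h2
    refine evRel_iff.2 ⟨hZ, ?_⟩
    rw [← valueRel_eq_of_funCon h1 hZ.1]
    exact (isApprox_valueRel h.1.1).cons hZ.2 h2 (evRel_iff.1 h).2

variable (A B) in
/-- Evaluation. -/
def ev : (funSpace A B).prod A ⟶ B := ⟨evRel A B, isApprox_evRel A B⟩

/-- Currying. -/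
def curry (H : C.prod A ⟶ B) : C ⟶ funSpace A B := ⟨lamRel H.rel, isApprox_lamRel H.isApprox⟩

/-- The composite is the union of the mappings represented by consistent pairs of tokens related by
G. Left interpolation of `valueRel` supplies the intermediate argument that the identity on `A` has
to entail. -/
theorem prodMap_comp_ev_rel (G : C ⟶ funSpace A B) {p : C.prod A} {Q : Finset (C.prod A)} {b : B} :
    (prodMap G (𝟙 A) ≫ ev A B).rel p Q b ↔ (C.prod A).Con p Q ∧
      ∃ w F, funCon A B w F ∧ G.rel p.1 (Q.image Prod.fst) w ∧
        (∀ x ∈ F, G.rel p.1 (Q.image Prod.fst) x) ∧ valueRel w F p.2 (Q.image Prod.snd) b := by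
  constructor
  · rintro ⟨⟨w, a⟩, Z, -, h1, h2, h3⟩
    obtain ⟨hZ, hb⟩ := evRel_iff.1 h3
    obtain ⟨hw, ha⟩ := (prodMap_rel _ _ _ _ _).1 h1
    have ha : A.Ent p.2 (Q.image Prod.snd) a := ha
    refine ⟨⟨G.isApprox.dom hw, A.isISW.ent_con ha⟩, w, Z.image Prod.fst, hZ.1, hw, ?_, ?_⟩
    · intro x hx
      obtain ⟨q, hq, rfl⟩ := Finset.mem_image.1 hx
      exact ((prodMap_rel _ _ _ _ _).1 (h2 q hq)).1
    · refine valueRel_of_infoLe hZ.1 (A.isISW.ent_con ha) (infoLe_of_ent ha ?_) hb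
      intro c hc
      obtain ⟨q, hq, rfl⟩ := Finset.mem_image.1 hc
      exact ((prodMap_rel _ _ _ _ _).1 (h2 q hq)).2
  · rintro ⟨hQ, w, F, hF, hw, hx, hb⟩
    obtain ⟨a, U, -, ha, hU, hUb⟩ := (isApprox_valueRel hF).left (F := {b}) hb.1 (by simpa using hb)
    have hbox := evRel_box hF (hUb b (Finset.mem_singleton_self b))
    refine ⟨(w, a), _, hbox.1, (prodMap_rel _ _ _ _ _).2 ⟨hw, ha⟩, fun q hq => ?_, hbox⟩
    exact (prodMap_rel _ _ _ _ _).2 (forall_mem_box (A := funSpace A B) (B := A)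
      (rel_bot G.isApprox hQ.1) (A.ent_bot' hQ.2) hx hU q hq)

theorem infoLe_box_image {p : C.prod A} {Q : Finset (C.prod A)} (hQ : (C.prod A).Con p Q) :
    InfoLe (C.prod A) p Q p
      (box C.toWitSystem A.toWitSystem (Q.image Prod.fst) (Q.image Prod.snd)) :=
  fun _ hr => (ent_box hQ.1 hQ.2).2 hr

theorem box_image_infoLe {p : C.prod A} {Q : Finset (C.prod A)} (hQ : (C.prod A).Con p Q) :
    InfoLe (C.prod A) p
      (box C.toWitSystem A.toWitSystem (Q.image Prod.fst) (Q.image Prod.snd)) p Q :=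
  fun r hr => (ent_box (q := r) hQ.1 hQ.2).1 hr

/-- Let f be H with its first argument fixed. Tokens below f represent only pairs of f, and each
single pair of f is recovered from one token below f together with a witness. -/
theorem prodMap_curry_comp_ev (H : C.prod A ⟶ B) :
    prodMap (curry H) (𝟙 A) ≫ ev A B = H := by
  apply Hom.ext; funext p Q b; apply propext
  rw [prodMap_comp_ev_rel]
  constructor
  · rintro ⟨hQ, w, F, hF, hw, hx, hb⟩
    exact rel_of_infoLe H.isApprox (box_image_infoLe hQ) (rel_of_valueRel
      (isApprox_fixFst H.isApprox hQ.1) hF hw.2 (fun x h => (hx x h).2) hb)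
  · intro h
    have hQ := H.isApprox.dom h
    have hf := isApprox_fixFst H.isApprox hQ.1
    obtain ⟨z, hz, hzb⟩ := exists_tok_valueRel hf (V := {((p.2, Q.image Prod.snd), b)}) (by
      intro q hq
      rw [Finset.mem_singleton.1 hq]
      exact rel_of_infoLe H.isApprox (infoLe_box_image hQ) h)
    have hz' : ∀ y ∈ ({z} : Finset (funSpace A B)),
        Below (fixFst H.rel p.1 (Q.image Prod.fst)) y := by simpa
    obtain ⟨w, hw, hwz⟩ := exists_witness_below hf hz'
    exact ⟨hQ, w, {z}, hwz, ⟨hQ.1, hw⟩, fun y hy => ⟨hQ.1, hz' y hy⟩,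
      hzb w hwz _ (Finset.mem_singleton_self _)⟩

theorem fixFst_comp_ev (G : C ⟶ funSpace A B) {c : C} {S : Finset C} (hS : C.Con c S) {i : A}
    {X : Finset A} {b : B} : fixFst (prodMap G (𝟙 A) ≫ ev A B).rel c S i X b ↔
      ∃ w F, funCon A B w F ∧ G.rel c S w ∧ (∀ x ∈ F, G.rel c S x) ∧ valueRel w F i X b := by
  -- Padding the empty set with the distinguished token adds no information.
  have h1 : ∀ x, G.rel c (if S = ∅ then {C.bot} else S) x ↔ G.rel c S x := fun x =>
    ⟨rel_of_infoLe G.isApprox (infoLe_pad hS),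
      G.isApprox.mono hS (C.con_pad hS) subset_pad⟩
  rw [fixFst, prodMap_comp_ev_rel, image_fst_box, image_snd_box]
  simp only [h1]
  constructor
  · rintro ⟨hQ, w, F, hF, hw, hx, hb⟩
    have hX := hb.1
    exact ⟨w, F, hF, hw, hx, valueRel_of_infoLe hF (A.isISW.con_subset subset_pad hX)
      (infoLe_pad (A.isISW.con_subset subset_pad hX)) hb⟩
  · rintro ⟨w, F, hF, hw, hx, hb⟩
    exact ⟨con_box (A := C) (B := A) (p := (c, i)) hS hb.1, w, F, hF, hw, hx, (isApprox_valueRel hF).mono hb.1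
      (A.con_pad hb.1) subset_pad hb⟩

/-- Each step of x holds in the mapping represented by some consistent pair related by G. As there
are finitely many steps, a common witness merges these pairs into one, which then entails x; closure
of G under entailment gives the result. The converse is right interpolation of G. -/
theorem lamRel_comp_ev (G : C ⟶ funSpace A B) :
    lamRel (prodMap G (𝟙 A) ≫ ev A B).rel = G.rel := by
  funext c S x; apply propext
  constructor
  · rintro ⟨hS, hx⟩
    have hV : ∀ p ∈ x.V, ∃ w F, funCon A B w F ∧ G.rel c S w ∧ (∀ y ∈ F, G.rel c S y) ∧
        valueRel w F p.1.1 p.1.2 p.2 := fun p hp => (fixFst_comp_ev G hS).1 (hx.1 p hp)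
    have : Nonempty (FunTok A.toWitSystem B.toWitSystem) := ⟨botTok A B⟩
    choose! w F h1 h2 h3 h4 using hV
    have hE : ∀ y ∈ x.V.biUnion fun p => insert (w p) (F p), G.rel c S y := by
      intro y hy
      obtain ⟨p, hp, hy⟩ := Finset.mem_biUnion.1 hy
      rcases Finset.mem_insert.1 hy with rfl | hy
      · exact h2 p hp
      · exact h3 p hp y hy
    obtain ⟨e, he, heE⟩ := G.isApprox.witness hS hE
    have heE' : funCon A B e (x.V.biUnion fun p => insert (w p) (F p)) := heE
    refine G.isApprox.ent_right hS heE he hE (funEnt_iff.2 ⟨heE', ?_⟩)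
    refine Below.of_steps (isApprox_valueRel heE')
      (isApprox_fixFst (prodMap G (𝟙 A) ≫ ev A B).isApprox hS)
      (fun i X b hb => (fixFst_comp_ev G hS).2 ⟨e, _, heE', he, hE, hb⟩) hx fun p hp => ?_
    have hsub := Finset.subset_biUnion_of_mem (fun p => insert (w p) (F p)) hp
    have hw : funCon A B e {w p} := funCon_subset
      (Finset.singleton_subset_iff.2 (hsub (Finset.mem_insert_self _ _))) heE'
    have hv := h4 p hp
    -- Since `w p` lies in the merged set witnessed by e, replacing `w p` by e leaves the
    -- represented mapping unchanged, and enlarging `F p` only adds pairs.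
    rw [← valueRel_eq_of_funCon hw (h1 p hp)] at hv
    exact valueRel_mono ((Finset.subset_insert _ _).trans hsub) heE' hv
  · intro h
    have hS := G.isApprox.dom h
    obtain ⟨w, F, hF, hw, hx, hE⟩ := G.isApprox.interp_right h
    exact ⟨hS, Below.mono (g := fixFst (prodMap G (𝟙 A) ≫ ev A B).rel c S)
      (fun i X b hb => (fixFst_comp_ev G hS).2 ⟨w, F, hF, hw, hx, hb⟩) (funEnt_iff.1 hE).2⟩

end Exponent

end ISW

/-! ### The exponent theorem -/

theorem mainTheorem2 (A A' : ISW.{u}) :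
    ∃ (hE : (ISW.funSpaceData A A').IsISW)
      (hev : WitSystem.IsApprox
        (ISW.prod ⟨ISW.funSpaceData A A', hE⟩ A).toWitSystem A'.toWitSystem (ISW.evRel A A')),
      ISW.IsExponent A A' ⟨ISW.funSpaceData A A', hE⟩ ⟨ISW.evRel A A', hev⟩ ∧
      ∀ C : ISW.{u},
        (∀ H : C.prod A ⟶ A',
          ∃ hΛ : WitSystem.IsApprox C.toWitSystem (ISW.funSpaceData A A') (ISW.lamRel H.rel),
            ISW.prodMap (A' := ⟨ISW.funSpaceData A A', hE⟩) ⟨ISW.lamRel H.rel, hΛ⟩ (𝟙 A) ≫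
              (⟨ISW.evRel A A', hev⟩ : ISW.prod ⟨ISW.funSpaceData A A', hE⟩ A ⟶ A') = H) ∧
        ∀ G : C ⟶ (⟨ISW.funSpaceData A A', hE⟩ : ISW.{u}),
          ISW.lamRel (ISW.prodMap G (𝟙 A) ≫
            (⟨ISW.evRel A A', hev⟩ : ISW.prod ⟨ISW.funSpaceData A A', hE⟩ A ⟶ A')).rel = G.rel := by
  refine ⟨ISW.funSpace_isISW A A', ISW.isApprox_evRel A A', fun C H => ?_, fun C => ⟨fun H =>
    ⟨ISW.isApprox_lamRel H.isApprox, ISW.prodMap_curry_comp_ev H⟩, ISW.lamRel_comp_ev⟩⟩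
  -- Uniqueness: a solution G is the currying of its own composite with evaluation, which is H.
  refine ⟨ISW.curry H, ISW.prodMap_curry_comp_ev H, fun G hG => ?_⟩
  apply ISW.Hom.ext
  rw [← hG]
  exact (ISW.lamRel_comp_ev G).symm
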